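/- **Definitions.** A *2-crossed module* $\mathcal A=(L\xrightarrow{\delta}E\xrightarrow{\partial}G,\triangleright,\{\,,\})$ is a complex of groups ($\partial\delta=1$) with left actions $\triangleright$ of $G$ on $L$ and $E$ by automorphisms (and on $G$ by conjugation) for which $\delta,\partial$ are $G$-equivariant, together with a $G$-equivariant map $\{\,,\}\colon E\times E\to L$ such that, writing $e\triangleright' l=l\{\delta(l)^{-1},e\}$, for all $e,f,g\in E$ and $k,l\in L$: $\delta\{e,f\}=efe^{-1}\,(\partial(e)\triangleright f^{-1})$; $\{\delta(l),\delta(k)\}=lkl^{-1}k^{-1}$; $\{\delta(l),e\}\{e,\delta(l)\}=l\,(\partial(e)\triangleright l^{-1})$; $\{ef,g\}=\{e,fgf^{-1}\}\,\partial(e)\triangleright\{f,g\}$; $\{e,fg\}=\{e,f\}\,(\partial(e)\triangleright f)\triangleright'\{e,g\}$. A *(strict) map* $f=(\mu,\psi,\phi)\colon\mathcal A\to\mathcal A'=(L'\to E'\to G')$ is a triple of group morphisms $L\to L'$, $E\to E'$, $G\to G'$ commuting with $\delta,\partial$, the actions and the liftings. A *homotopy* from $f=(\mu,\psi,\phi)$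 to $f'=(\mu',\psi',\phi')$, both maps $\mathcal A\to\mathcal A'$, is a pair of set maps $s\colon G\to E'$, $t\colon E\to L'$ such that for all $g,h\in G$ and $a,b\in E$ $$s(gh)=(\phi(h)^{-1}\triangleright s(g))\,s(h),$$ $$t(ab)=\big(\psi(b)\,s(\partial b)\big)^{-1}\triangleright'\Big(\big\{\psi(b),\phi(\partial(b)^{-1})\triangleright s(\partial a)^{-1}\big\}\,t(a)\Big)\,t(b),$$ $$t(g\triangleright a)=\phi(g)\triangleright\Big(\big(s(g)s(\partial a)^{-1}\big)\triangleright'\{\psi(a)^{-1},s(g)^{-1}\}^{-1}\Big)\;\phi(g)\triangleright\{s(g),s(\partial a)^{-1}\psi(a)^{-1}\}\;\big(\phi(g)\,\partial(s(g))\big)\triangleright t(a),$$ and, for all $l\in L$, $a\in E$, $g\in G$, $\mu'(l)=\mu(l)\,t(\delta l)$, $\psi'(a)=\psi(a)\,s(\partial a)\,\delta(t(a))$, $\phi'(g)=\phi(g)\,\partial(s(g))$. Let $F(G)$ be the free group on the underlying set of $G$, and $p\colon F(G)\to G$ the morphism that sends each generator to the corresponding element of $G$. Let $Q^1(\mathcal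 A)=\big(L\to E\times_G F(G)\to F(G)\big)$, where $E\times_GF(G)=\{(e,u):\partial(e)=p(u)\}$, with $\delta'(k)=(\delta(k),1)$, $\partial'(e,u)=u$, $u\triangleright k=p(u)\triangleright k$, $u\triangleright(e,u')=(p(u)\triangleright e,uu'u^{-1})$ and $\{(e,u),(e',u')\}=\{e,e'\}$. This is a 2-crossed module, and $(\mathrm{id}_L,(e,u)\mapsto e,p)$ is a map $\mathrm{proj}\colon Q^1(\mathcal A)\to\mathcal A$. A *lax homotopy* from $f$ to $f'$, both maps $\mathcal A\to\mathcal A'$, is a homotopy from $f\circ\mathrm{proj}$ to $f'\circ\mathrm{proj}$. A map $f\colon\mathcal A\to\mathcal A'$ is a *lax homotopy equivalence* if there are a map $g\colon\mathcal A'\to\mathcal A$, a lax homotopy from $\mathrm{id}_{\mathcal A}$ to $g\circ f$ and a lax homotopy from $\mathrm{id}_{\mathcal A'}$ to $f\circ g$. **Proposition.** In the category of 2-crossed modules and strict maps: 1. the composite of two lax homotopy equivalences is a lax homotopy equivalence; 2. for composable maps $f\colon\mathcal A\to\mathcal A'$ and $f'\colon\mathcal A'\to\mathcal A''$, if two of the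 three maps $f$, $f'$, $f'\circ f$ are lax homotopy equivalences, then so is the third; 3. every retract (in the category of arrows) of a lax homotopy equivalence is a lax homotopy equivalence. -/

import Mathlib

open CategoryTheory

universe u

/-- The Peiffer commutator `⟨x, y⟩ = (x y x⁻¹) (∂(x) ▷ y⁻¹)` of a pre-crossed module. -/
def peifferCommutator {E G : Type u} [Group E] [Group G] [MulDistribMulAction G E]
    (bdry : E →* G) (x y : E) : E :=
  (x * y * x⁻¹) * (bdry x • y⁻¹)

/-- The secondary action `e ▷' l = l {δ(l)⁻¹, e}` determined by `δ : L → E` and the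
Peiffer lifting `{ , } : E × E → L`. -/
def secondaryAction {L E : Type u} [Group L] [Group E]
    (delta : L →* E) (lift : E → E → L) (e : E) (l : L) : L :=
  l * lift (delta l)⁻¹ e

/-- A 2-crossed module of groups `L --δ--> E --∂--> G`, with left actions by automorphisms
`▷` of `G` on `E` and on `L` (written `•`), and a Peiffer lifting `{ , } : E × E → L`. -/
structure TwoCrossedModule : Type (u + 1) where
  L : Type u
  E : Type u
  G : Type u
  [groupL : Group L]
  [groupE : Group E]
  [groupG : Group G]
  [actL : MulDistribMulAction G L]
  [actE : MulDistribMulAction G E]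
  delta : L →* E
  bdry : E →* G
  lift : E → E → L
  bdry_delta : ∀ l : L, bdry (delta l) = 1
  delta_smul : ∀ (g : G) (l : L), delta (g • l) = g • delta l
  bdry_smul : ∀ (g : G) (e : E), bdry (g • e) = g * bdry e * g⁻¹
  smul_lift : ∀ (g : G) (e f : E), g • lift e f = lift (g • e) (g • f)
  delta_lift : ∀ e f : E, delta (lift e f) = peifferCommutator bdry e f
  lift_delta_delta : ∀ l k : L, lift (delta l) (delta k) = l * k * l⁻¹ * k⁻¹
  lift_delta_mul : ∀ (l : L) (e : E),
    lift (delta l) e * lift e (delta l) = l * (bdry e • l⁻¹)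
  lift_mul_left : ∀ e f g : E,
    lift (e * f) g = lift e (f * g * f⁻¹) * (bdry e • lift f g)
  lift_mul_right : ∀ e f g : E,
    lift e (f * g) = lift e f * secondaryAction delta lift (bdry e • f) (lift e g)

namespace TwoCrossedModule

attribute [instance] groupL groupE groupG actL actE

/-- The secondary action `e ▷' l` of a 2-crossed module. -/
def sec (A : TwoCrossedModule.{u}) (e : A.E) (l : A.L) : A.L :=
  secondaryAction A.delta A.lift e l

/-- A (strict) 2-crossed module map `(μ, ψ, φ)`. -/
@[ext]
structure Hom (A B : TwoCrossedModule.{u}) : Type u where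
  μ : A.L →* B.L
  ψ : A.E →* B.E
  φ : A.G →* B.G
  delta_comm : ∀ l : A.L, B.delta (μ l) = ψ (A.delta l)
  bdry_comm : ∀ e : A.E, B.bdry (ψ e) = φ (A.bdry e)
  map_lift : ∀ e f : A.E, μ (A.lift e f) = B.lift (ψ e) (ψ f)
  map_smul_L : ∀ (g : A.G) (l : A.L), μ (g • l) = φ g • μ l
  map_smul_E : ∀ (g : A.G) (e : A.E), ψ (g • e) = φ g • ψ e

/-- The category of 2-crossed modules and strict maps. -/
instance : Category TwoCrossedModule.{u} where
  Hom := Hom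
  id A :=
    { μ := MonoidHom.id _
      ψ := MonoidHom.id _
      φ := MonoidHom.id _
      delta_comm := fun _ => rfl
      bdry_comm := fun _ => rfl
      map_lift := fun _ _ => rfl
      map_smul_L := fun _ _ => rfl
      map_smul_E := fun _ _ => rfl }
  comp f g :=
    { μ := g.μ.comp f.μ
      ψ := g.ψ.comp f.ψ
      φ := g.φ.comp f.φ
      delta_comm := fun l => by simp [g.delta_comm, f.delta_comm]
      bdry_comm := fun e => by simp [g.bdry_comm, f.bdry_comm]
      map_lift := fun e e' => by simp [g.map_lift, f.map_lift]
      map_smul_L := fun a l => by simp [g.map_smul_L, f.map_smul_L]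
      map_smul_E := fun a e => by simp [g.map_smul_E, f.map_smul_E] }

/-- For a 2-crossed module map `f = (μ, ψ, φ) : A ⟶ B`, a quadratic `f`-derivation is a pair
of set maps `s : G → E'`, `t : E → L'` satisfying the three identities below. -/
structure QuadraticDerivation {A B : TwoCrossedModule.{u}} (f : A ⟶ B) where
  s : A.G → B.E
  t : A.E → B.L
  s_mul : ∀ g h : A.G, s (g * h) = ((f.φ h)⁻¹ • s g) * s h
  t_mul : ∀ a b : A.E,
    t (a * b) =
      B.sec (f.ψ b * s (A.bdry b))⁻¹
        (B.lift (f.ψ b) (f.φ (A.bdry b)⁻¹ • (s (A.bdry a))⁻¹) * t a) * t b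
  t_smul : ∀ (g : A.G) (a : A.E),
    t (g • a) =
      (f.φ g • B.sec (s g * (s (A.bdry a))⁻¹) (B.lift (f.ψ a)⁻¹ (s g)⁻¹)⁻¹)
        * (f.φ g • B.lift (s g) ((s (A.bdry a))⁻¹ * (f.ψ a)⁻¹))
        * ((f.φ g * B.bdry (s g)) • t a)

/-- A homotopy from `f` to `f'`: a quadratic `f`-derivation connecting `f` and `f'`. -/
structure Homotopy {A B : TwoCrossedModule.{u}} (f f' : A ⟶ B) extends
    QuadraticDerivation f where
  μ_eq : ∀ l : A.L, f'.μ l = f.μ l * t (A.delta l)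
  ψ_eq : ∀ a : A.E, f'.ψ a = f.ψ a * s (A.bdry a) * B.delta (t a)
  φ_eq : ∀ g : A.G, f'.φ g = f.φ g * B.bdry (s g)

section Resolution

variable (A : TwoCrossedModule.{u})

/-- The projection `p` from the free group on the underlying set of `G` to `G`, `[g] ↦ g`. -/
def freeProj : FreeGroup A.G →* A.G := FreeGroup.lift id

/-- The pullback of `∂ : E → G` and `p`, as a subgroup of the product. -/
def pullbackE : Subgroup (A.E × FreeGroup A.G) where
  carrier := {x | A.bdry x.1 = A.freeProj x.2}
  mul_mem' := by
    intro x y hx hy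
    simp only [Set.mem_ofPred_eq] at hx hy ⊢
    simp [hx, hy]
  one_mem' := by simp
  inv_mem' := by
    intro x hx
    simp only [Set.mem_ofPred_eq] at hx ⊢
    simp [hx]

/-- `u ▷ k = p(u) ▷ k` for `u` in the free group and `k ∈ L`. -/
@[reducible]
def resActL : MulDistribMulAction (FreeGroup A.G) A.L :=
  MulDistribMulAction.compHom A.L A.freeProj

/-- `u ▷ (e, u') = (p(u) ▷ e, u u' u⁻¹)` on the pullback. -/
@[reducible]
def resActE : MulDistribMulAction (FreeGroup A.G) A.pullbackE where
  smul v x := ⟨(A.freeProj v • x.1.1, v * x.1.2 * v⁻¹), by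
    have hx : A.bdry x.1.1 = A.freeProj x.1.2 := x.2
    change A.bdry (A.freeProj v • x.1.1) = A.freeProj (v * x.1.2 * v⁻¹)
    rw [A.bdry_smul, hx, map_mul, map_mul, map_inv]⟩
  one_smul x := by
    apply Subtype.ext
    apply Prod.ext
    · change A.freeProj 1 • x.1.1 = x.1.1
      rw [map_one, one_smul]
    · change 1 * x.1.2 * 1⁻¹ = x.1.2
      group
  mul_smul v w x := by
    apply Subtype.ext
    apply Prod.ext
    · change A.freeProj (v * w) • x.1.1 = A.freeProj v • A.freeProj w • x.1.1
      rw [map_mul, mul_smul]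
    · change v * w * x.1.2 * (v * w)⁻¹ = v * (w * x.1.2 * w⁻¹) * v⁻¹
      group
  smul_mul v x y := by
    apply Subtype.ext
    apply Prod.ext
    · change A.freeProj v • (x.1.1 * y.1.1) = (A.freeProj v • x.1.1) * (A.freeProj v • y.1.1)
      rw [smul_mul']
    · change v * (x.1.2 * y.1.2) * v⁻¹ = (v * x.1.2 * v⁻¹) * (v * y.1.2 * v⁻¹)
      group
  smul_one v := by
    apply Subtype.ext
    apply Prod.ext
    · change A.freeProj v • (1 : A.E) = 1
      rw [smul_one]
    · change v * 1 * v⁻¹ = 1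
      group

/-- The partial resolution `Q¹(A)`: `L → E ×_G F(G) → F(G)`, with `δ'(k) = (δ(k), 1)`,
`∂'(e, u) = u` and Peiffer lifting `{(e, u), (e', u')} = {e, e'}`. -/
def Q1 : TwoCrossedModule.{u} :=
  letI := A.resActL
  letI := A.resActE
  { L := A.L
    E := A.pullbackE
    G := FreeGroup A.G
    delta :=
      { toFun := fun k => ⟨(A.delta k, 1), by
          change A.bdry (A.delta k) = A.freeProj 1
          rw [A.bdry_delta, map_one]⟩
        map_one' := by
          apply Subtype.ext
          simp
        map_mul' := fun x y => by
          apply Subtype.ext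
          simp }
    bdry := (MonoidHom.snd A.E (FreeGroup A.G)).comp A.pullbackE.subtype
    lift := fun x y => A.lift x.1.1 y.1.1
    bdry_delta := fun _ => rfl
    delta_smul := fun v l => by
      apply Subtype.ext
      apply Prod.ext
      · exact A.delta_smul (A.freeProj v) l
      · change (1 : FreeGroup A.G) = v * 1 * v⁻¹
        group
    bdry_smul := fun _ _ => rfl
    smul_lift := fun v x y => A.smul_lift (A.freeProj v) x.1.1 y.1.1
    delta_lift := fun x y => by
      have hx : A.bdry x.1.1 = A.freeProj x.1.2 := x.2
      apply Subtype.ext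
      apply Prod.ext
      · change A.delta (A.lift x.1.1 y.1.1) =
          x.1.1 * y.1.1 * x.1.1⁻¹ * (A.freeProj x.1.2 • y.1.1⁻¹)
        rw [A.delta_lift, peifferCommutator, hx]
      · change (1 : FreeGroup A.G) =
          x.1.2 * y.1.2 * x.1.2⁻¹ * (x.1.2 * y.1.2⁻¹ * x.1.2⁻¹)
        group
    lift_delta_delta := A.lift_delta_delta
    lift_delta_mul := fun l x => by
      have hx : A.bdry x.1.1 = A.freeProj x.1.2 := x.2
      change A.lift (A.delta l) x.1.1 * A.lift x.1.1 (A.delta l) = l * (A.freeProj x.1.2 • l⁻¹)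
      rw [A.lift_delta_mul, hx]
    lift_mul_left := fun x y z => by
      have hx : A.bdry x.1.1 = A.freeProj x.1.2 := x.2
      change A.lift (x.1.1 * y.1.1) z.1.1 =
        A.lift x.1.1 (y.1.1 * z.1.1 * y.1.1⁻¹) * (A.freeProj x.1.2 • A.lift y.1.1 z.1.1)
      rw [A.lift_mul_left, hx]
    lift_mul_right := fun x y z => by
      have hx : A.bdry x.1.1 = A.freeProj x.1.2 := x.2
      change A.lift x.1.1 (y.1.1 * z.1.1) = A.lift x.1.1 y.1.1 *
        secondaryAction A.delta A.lift (A.freeProj x.1.2 • y.1.1) (A.lift x.1.1 z.1.1)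
      rw [A.lift_mul_right, hx] }

/-- The projection `proj : Q¹(A) ⟶ A`, equal to the identity on `L`, to `(e, u) ↦ e` on the
pullback and to `p` on the free group. -/
def proj : A.Q1 ⟶ A where
  μ := MonoidHom.id A.L
  ψ := (MonoidHom.fst A.E (FreeGroup A.G)).comp A.pullbackE.subtype
  φ := A.freeProj
  delta_comm := fun _ => rfl
  bdry_comm := fun x => x.2
  map_lift := fun _ _ => rfl
  map_smul_L := fun _ _ => rfl
  map_smul_E := fun _ _ => rfl

end Resolution

/-- A lax homotopy between strict maps `f, f' : A ⟶ B`: a homotopy between the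
composites `Q¹(A) ⟶ A ⟶ B`. -/
def LaxHomotopy {A B : TwoCrossedModule.{u}} (f f' : A ⟶ B) : Type u :=
  Homotopy (A.proj ≫ f) (A.proj ≫ f')

/-- The class of lax homotopy equivalences: the maps `f : A ⟶ B` for which there are a map
`g : B ⟶ A` and lax homotopies from `id` to `g ∘ f` and from `id` to `f ∘ g`. -/
def laxHomotopyEquivalences : MorphismProperty TwoCrossedModule.{u} :=
  fun A B f => ∃ g : B ⟶ A,
    Nonempty (LaxHomotopy (𝟙 A) (f ≫ g)) ∧ Nonempty (LaxHomotopy (𝟙 B) (g ≫ f))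

end TwoCrossedModule

/-! Lax homotopy turns out to be a congruence on the category of 2-crossed modules, so the lax
homotopy equivalences are exactly the maps that the quotient functor sends to isomorphisms
(`laxHomotopyEquivalences_eq`). Isomorphisms have all three closure properties, and these pass to
inverse images under a functor.

Reflexivity is the constant homotopy. Postcomposition is direct, and precomposition uses the
functoriality of Q¹ together with the naturality of `proj`. What remains is symmetry and
transitivity. Given reflexivity, both follow from one statement: homotopies f₀ → f₁ and f₀ → f₂ out
of Q¹(A) yield a homotopy f₁ → f₂ (`Homotopy.nonempty_of_common_source`).

To avoid computing with the derivation identities, the target is replaced by its simplicial group: E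
⋊ G in degree 1 and (L ⋊ E) ⋊ (E ⋊ G) in degree 2. A homotopy becomes a pair of group homomorphisms,
from G to the 1-simplices and from E to the 2-simplices. The formula for t(ab) is the product of
2-simplices (`triangle_mul`), and the one for t(g ▷ a) is an equivariance relation
(`isEquivariantAt_triangle`). Two homotopies with common source are then composed by filling horns.
Over G, a homomorphism into the 2-simplices with two prescribed faces is needed; it exists because
the base group of Q¹(A) is free. Over E, a 3-dimensional horn arises, and its missing face is given
by the explicit word `fill`. This word is multiplicative on horns (`fill_mul`) and compatible with
equivariance (`fill_isEquivariantAt`), because an element of two face kernels commutes with every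
element of the third. -/

/-- A homomorphism from a group to the endomorphisms of a group takes values in automorphisms. -/
def MonoidHom.toMulAutOfEnd {G K : Type*} [Group G] [Group K] (F : G →* Monoid.End K) :
    G →* MulAut K where
  toFun g :=
    { toFun := F g
      invFun := F g⁻¹
      left_inv := fun k => by
        change (F g⁻¹ * F g) k = k
        rw [← map_mul, inv_mul_cancel, map_one]; rfl
      right_inv := fun k => by
        change (F g * F g⁻¹) k = k
        rw [← map_mul, mul_inv_cancel, map_one]; rfl
      map_mul' := map_mul (F g) }
  map_one' := by
    ext k
    change F 1 k = k
    rw [map_one]; rfl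
  map_mul' g h := by
    ext k
    change F (g * h) k = F g (F h k)
    rw [map_mul]; rfl

namespace TwoCrossedModule

/-! ### Identities for the Peiffer lifting and the secondary action. -/

section Algebra

variable (A : TwoCrossedModule.{u})

lemma lift_one_left (e : A.E) : A.lift 1 e = 1 := by
  have h := A.lift_mul_left 1 1 e
  simpa using h

lemma lift_delta_one (l : A.L) : A.lift (A.delta l) 1 = 1 := by
  have h1 : A.lift 1 (A.delta l) = 1 := A.lift_one_left _
  have h := A.lift_delta_mul l 1
  simpa [h1] using h

lemma sec_def (e : A.E) (l : A.L) : A.sec e l = l * A.lift (A.delta l)⁻¹ e := rfl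

lemma lift_mul_right' (e f g : A.E) :
    A.lift e (f * g) = A.lift e f * A.sec (A.bdry e • f) (A.lift e g) := A.lift_mul_right e f g

lemma sec_one (l : A.L) : A.sec 1 l = l := by
  rw [sec_def, ← map_inv, lift_delta_one, mul_one]

lemma lift_one_right (e : A.E) : A.lift e 1 = 1 := by
  have h := A.lift_mul_right' e 1 1
  simpa [sec_one] using h

lemma sec_delta (k l : A.L) : A.sec (A.delta k) l = k * l * k⁻¹ := by
  rw [sec_def, ← map_inv, A.lift_delta_delta]
  group

/-- This trades {δ(l), e} for {e, δ(l)}, so that the axiom for a product in the right-hand argument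
becomes available for the secondary action. -/
lemma sec_inv_inv (e : A.E) (l : A.L) :
    (A.sec e l⁻¹)⁻¹ = A.lift e (A.delta l) * A.bdry e • l := by
  have h := A.lift_delta_mul l e
  have h' : A.lift (A.delta l) e = l * A.bdry e • l⁻¹ * (A.lift e (A.delta l))⁻¹ := by
    rw [← h]; group
  rw [sec_def, map_inv, inv_inv, h', smul_inv']
  group

/-- Multiplicativity is not visible in l{δ(l)⁻¹, e}. In the form of `sec_inv_inv` it follows from
`lift_mul_right'`, since δ(k) acts on L by conjugation. -/
lemma sec_mul_right (e : A.E) (k l : A.L) : A.sec e (k * l) = A.sec e k * A.sec e l := by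
  have key : ∀ k l : A.L, (A.sec e (k * l)⁻¹)⁻¹ = (A.sec e k⁻¹)⁻¹ * (A.sec e l⁻¹)⁻¹ := by
    intro k l
    rw [sec_inv_inv, sec_inv_inv, sec_inv_inv, map_mul, lift_mul_right', ← A.delta_smul,
      sec_delta, smul_mul']
    group
  have h := key l⁻¹ k⁻¹
  rw [← mul_inv_rev, ← mul_inv_rev, inv_inv, inv_inv, inv_inv] at h
  exact inv_injective h

lemma sec_inv (e : A.E) (l : A.L) : A.sec e l⁻¹ = (A.sec e l)⁻¹ :=
  map_inv (MonoidHom.mk' (A.sec e) (A.sec_mul_right e)) l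

lemma sec_mul (e f : A.E) (l : A.L) : A.sec (e * f) l = A.sec e (A.sec f l) := by
  rw [A.sec_def f, sec_mul_right, sec_def, ← map_inv, lift_mul_right', A.bdry_delta, one_smul,
    ← mul_assoc, map_inv, ← sec_def]

/-- The secondary action as a homomorphism to endomorphisms. -/
def secEnd : A.E →* Monoid.End A.L where
  toFun e := MonoidHom.mk' (A.sec e) (A.sec_mul_right e)
  map_one' := by ext l; exact A.sec_one l
  map_mul' e f := by ext l; exact A.sec_mul e f l

/-- The secondary action as a homomorphism to automorphisms. -/
def secAut : A.E →* MulAut A.L := A.secEnd.toMulAutOfEnd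

@[simp]
lemma secAut_apply (e : A.E) (l : A.L) : A.secAut e l = A.sec e l := rfl

lemma smul_sec (g : A.G) (e : A.E) (l : A.L) : g • A.sec e l = A.sec (g • e) (g • l) := by
  rw [sec_def, sec_def, smul_mul', A.smul_lift, smul_inv', A.delta_smul]

lemma delta_lift' (e f : A.E) : A.delta (A.lift e f) = e * f * e⁻¹ * (A.bdry e • f⁻¹) :=
  A.delta_lift e f

lemma delta_sec (e : A.E) (l : A.L) : A.delta (A.sec e l) = e * A.delta l * e⁻¹ := by
  rw [sec_def, map_mul, delta_lift', ← map_inv, A.bdry_delta, one_smul, map_inv]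
  group

/-- Obtained by writing fgf⁻¹ = δ{f, g} (∂f ▷ g) in the axiom. In this form the identity is exactly
what makes `conjE` multiplicative in its first argument. -/
lemma lift_mul_left' (e f g : A.E) :
    A.lift (e * f) g = A.sec e (A.lift f g) * A.lift e (A.bdry f • g) := by
  have h : f * g * f⁻¹ = A.delta (A.lift f g) * (A.bdry f • g) := by
    rw [delta_lift', smul_inv']; group
  have h' := A.sec_inv_inv e (A.lift f g)
  rw [sec_inv, inv_inv] at h'
  rw [A.lift_mul_left, h, lift_mul_right', ← A.delta_smul, sec_delta, h']
  group

/-- Conjugation by {e, f} is the secondary action of δ{e, f}, and δ{e, f} (∂e ▷ f) e = ef. This is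
the compatibility needed for `conjE` to be defined on the semidirect product. -/
lemma sec_mul_lift_sec (e f : A.E) (l : A.L) :
    A.sec (e * f) l = A.lift e f * A.sec ((A.bdry e • f) * e) l * (A.lift e f)⁻¹ := by
  rw [← sec_delta, ← sec_mul, delta_lift', smul_inv']
  congr 1
  group

end Algebra

/-! ### The groups of 1-simplices and 2-simplices as iterated semidirect products. -/

open SemidirectProduct

variable (A : TwoCrossedModule.{u})

/-- The group of `1`-simplices. -/
abbrev Edges : Type u := A.E ⋊[MulDistribMulAction.toMulAut A.G A.E] A.G

/-- The semidirect product of `L` and `E` for the secondary action. -/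
abbrev SecProd : Type u := A.L ⋊[A.secAut] A.E

/-- The endomorphism of `L ⋊ E` given by conjugation with the degenerate simplex on `e : E`. -/
def conjE (e : A.E) : A.SecProd →* A.SecProd :=
  SemidirectProduct.lift (inl.comp (A.secEnd e))
    (MonoidHom.mk' (fun f => inl (A.lift e f) * inr (A.bdry e • f)) fun f f' => by
      rw [lift_mul_right', smul_mul', map_mul, map_mul, ← secAut_apply, inl_aut, map_inv]
      group)
    fun f => by
      ext1 l
      change inl (A.sec e (A.sec f l)) = inl (A.lift e f) * inr (A.bdry e • f) *
        inl (A.sec e l) * (inl (A.lift e f) * inr (A.bdry e • f))⁻¹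
      rw [← sec_mul, sec_mul_lift_sec, sec_mul, ← secAut_apply, map_mul, map_mul, inl_aut,
        map_inv, map_inv]
      group

lemma conjE_inl (e : A.E) (l : A.L) : A.conjE e (inl l) = inl (A.sec e l) := by
  simp [conjE]; rfl

lemma conjE_inr (e f : A.E) :
    A.conjE e (inr f) = inl (A.lift e f) * inr (A.bdry e • f) := by
  simp [conjE]

/-- The action of `E` on `L ⋊ E`. -/
def conjEAut : A.E →* MulAut A.SecProd :=
  MonoidHom.toMulAutOfEnd
    { toFun := A.conjE
      map_one' := by
        apply SemidirectProduct.hom_ext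
        · ext1 l
          change A.conjE 1 (inl l) = inl l
          rw [conjE_inl, sec_one]
        · ext1 f
          change A.conjE 1 (inr f) = inr f
          rw [conjE_inr, lift_one_left, map_one, map_one, one_smul, one_mul]
      map_mul' := fun e e' => by
        apply SemidirectProduct.hom_ext
        · ext1 l
          change A.conjE (e * e') (inl l) = A.conjE e (A.conjE e' (inl l))
          rw [conjE_inl, conjE_inl, conjE_inl, sec_mul]
        · ext1 f
          change A.conjE (e * e') (inr f) = A.conjE e (A.conjE e' (inr f))
          rw [conjE_inr, conjE_inr, map_mul, map_mul, conjE_inl, conjE_inr, mul_smul,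
            lift_mul_left', map_mul, mul_assoc] }

/-- The endomorphism of `L ⋊ E` given by the action of `g : G`. -/
def conjG (g : A.G) : A.SecProd →* A.SecProd :=
  SemidirectProduct.map (MulDistribMulAction.toMonoidHom A.L g)
    (MulDistribMulAction.toMonoidHom A.E g) fun e => by
      ext1 l
      exact A.smul_sec g e l

lemma conjG_inl (g : A.G) (l : A.L) : A.conjG g (inl l) = inl (g • l) := by
  rw [conjG, SemidirectProduct.map_inl]; rfl

lemma conjG_inr (g : A.G) (e : A.E) : A.conjG g (inr e) = inr (g • e) := by
  rw [conjG, SemidirectProduct.map_inr]; rfl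

/-- The action of `G` on `L ⋊ E`. -/
def conjGAut : A.G →* MulAut A.SecProd :=
  MonoidHom.toMulAutOfEnd
    { toFun := A.conjG
      map_one' := by
        apply SemidirectProduct.hom_ext
        · ext1 l
          change A.conjG 1 (inl l) = inl l
          rw [conjG_inl, one_smul]
        · ext1 e
          change A.conjG 1 (inr e) = inr e
          rw [conjG_inr, one_smul]
      map_mul' := fun g g' => by
        apply SemidirectProduct.hom_ext
        · ext1 l
          change A.conjG (g * g') (inl l) = A.conjG g (A.conjG g' (inl l))
          rw [conjG_inl, conjG_inl, conjG_inl, mul_smul]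
        · ext1 e
          change A.conjG (g * g') (inr e) = A.conjG g (A.conjG g' (inr e))
          rw [conjG_inr, conjG_inr, conjG_inr, mul_smul] }

@[simp]
lemma conjGAut_inl (g : A.G) (l : A.L) : A.conjGAut g (inl l) = inl (g • l) :=
  A.conjG_inl g l

@[simp]
lemma conjGAut_inr (g : A.G) (e : A.E) : A.conjGAut g (inr e) = inr (g • e) :=
  A.conjG_inr g e

@[simp]
lemma conjEAut_inl (e : A.E) (l : A.L) : A.conjEAut e (inl l) = inl (A.sec e l) :=
  A.conjE_inl e l

@[simp]
lemma conjEAut_inr (e f : A.E) :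
    A.conjEAut e (inr f) = inl (A.lift e f) * inr (A.bdry e • f) :=
  A.conjE_inr e f

lemma conjGAut_conjEAut (g : A.G) (e : A.E) (x : A.SecProd) :
    A.conjGAut g (A.conjEAut e x) = A.conjEAut (g • e) (A.conjGAut g x) := by
  suffices h : (A.conjGAut g).toMonoidHom.comp (A.conjEAut e).toMonoidHom =
      (A.conjEAut (g • e)).toMonoidHom.comp (A.conjGAut g).toMonoidHom from
    DFunLike.congr_fun h x
  apply SemidirectProduct.hom_ext
  · ext1 l
    simp [smul_sec]
  · ext1 f
    simp [A.smul_lift, A.bdry_smul, mul_smul]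

/-- The action of `E ⋊ G` on `L ⋊ E`. -/
def edgesAut : A.Edges →* MulAut A.SecProd :=
  SemidirectProduct.lift A.conjEAut A.conjGAut fun g => by
    ext1 e
    ext1 x
    simp [conjGAut_conjEAut]

@[simp]
lemma edgesAut_inl (e : A.E) : A.edgesAut (inl e) = A.conjEAut e := by
  rw [edgesAut, lift_inl]

@[simp]
lemma edgesAut_inr (g : A.G) : A.edgesAut (inr g) = A.conjGAut g := by
  rw [edgesAut, lift_inr]

/-- The group of `2`-simplices. -/
abbrev Triangles : Type u := A.SecProd ⋊[A.edgesAut] A.Edges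

/-- The inclusion of `L` into the group of `2`-simplices. -/
def z : A.L →* A.Triangles := inl.comp inl

/-- The first degenerate inclusion of `E` into the group of `2`-simplices. -/
def p : A.E →* A.Triangles := inl.comp inr

/-- The second degenerate inclusion of `E` into the group of `2`-simplices. -/
def q : A.E →* A.Triangles := inr.comp inl

/-- The inclusion of `G` into the group of `2`-simplices. -/
def i : A.G →* A.Triangles := inr.comp inr

lemma p_mul_z (e : A.E) (l : A.L) : A.p e * A.z l = A.z (A.sec e l) * A.p e := by
  rw [← mul_inv_eq_iff_eq_mul, ← map_inv]
  simp only [p, z, MonoidHom.comp_apply, ← map_mul]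
  rw [← inl_aut]; rfl

lemma inr_mul_inl_eq (b : A.Edges) (x : A.SecProd) :
    (inr b * inl x : A.Triangles) = inl (A.edgesAut b x) * inr b := by
  rw [inl_aut, map_inv, inv_mul_cancel_right]

lemma q_mul_z (e : A.E) (l : A.L) : A.q e * A.z l = A.z (A.sec e l) * A.q e := by
  simp only [q, z, MonoidHom.comp_apply, inr_mul_inl_eq]
  simp

lemma q_mul_p (e f : A.E) :
    A.q e * A.p f = A.z (A.lift e f) * A.p (A.bdry e • f) * A.q e := by
  simp only [q, p, z, MonoidHom.comp_apply, inr_mul_inl_eq]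
  simp

lemma i_mul_z (g : A.G) (l : A.L) : A.i g * A.z l = A.z (g • l) * A.i g := by
  simp only [i, z, MonoidHom.comp_apply, inr_mul_inl_eq]
  simp

lemma i_mul_p (g : A.G) (e : A.E) : A.i g * A.p e = A.p (g • e) * A.i g := by
  simp only [i, p, MonoidHom.comp_apply, inr_mul_inl_eq]
  simp

lemma i_mul_q (g : A.G) (e : A.E) : A.i g * A.q e = A.q (g • e) * A.i g := by
  rw [← mul_inv_eq_iff_eq_mul, ← map_inv]
  simp only [i, q, MonoidHom.comp_apply, ← map_mul]
  rw [← inl_aut]; rfl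

/-- Normal form of a `2`-simplex. -/
lemma triangle_eq (h : A.Triangles) :
    h = A.z h.left.left * A.p h.left.right * A.q h.right.left * A.i h.right.right := by
  simp only [z, p, q, i, MonoidHom.comp_apply]
  rw [← map_mul, inl_left_mul_inr_right, mul_assoc, ← map_mul, inl_left_mul_inr_right,
    inl_left_mul_inr_right]

lemma z_injective : Function.Injective A.z := inl_injective.comp inl_injective

/-- The inclusion of `E` into the group of `1`-simplices. -/
def j : A.E →* A.Edges := inl

/-- The inclusion of `G` into the group of `1`-simplices. -/
def k : A.G →* A.Edges := inr

lemma k_mul_j (g : A.G) (e : A.E) : A.k g * A.j e = A.j (g • e) * A.k g := by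
  rw [← mul_inv_eq_iff_eq_mul, ← map_inv]
  simp only [j, k]
  rw [← inl_aut]; rfl

lemma edge_eq (b : A.Edges) : b = A.j b.left * A.k b.right :=
  (inl_left_mul_inr_right b).symm

variable {A} in
lemma edges_hom_ext {K : Type*} [Group K] {f g : A.Edges →* K} (hj : ∀ e, f (A.j e) = g (A.j e))
    (hk : ∀ x, f (A.k x) = g (A.k x)) : f = g :=
  SemidirectProduct.hom_ext (MonoidHom.ext hj) (MonoidHom.ext hk)

variable {A} in
lemma triangles_hom_ext {K : Type*} [Group K] {f g : A.Triangles →* K}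
    (hz : ∀ l, f (A.z l) = g (A.z l)) (hp : ∀ e, f (A.p e) = g (A.p e))
    (hq : ∀ e, f (A.q e) = g (A.q e)) (hi : ∀ x, f (A.i x) = g (A.i x)) : f = g :=
  SemidirectProduct.hom_ext
    (SemidirectProduct.hom_ext (MonoidHom.ext hz) (MonoidHom.ext hp))
    (SemidirectProduct.hom_ext (MonoidHom.ext hq) (MonoidHom.ext hi))

/-! ### Presentations of these groups by generators and commutation rules. -/

section Lift

variable {A} {K : Type*} [Group K]

/-- Universal property of the group of `1`-simplices. -/
def edgesLift (fj : A.E →* K) (fk : A.G →* K)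
    (h : ∀ g e, fk g * fj e = fj (g • e) * fk g) : A.Edges →* K :=
  SemidirectProduct.lift fj fk fun g => by
    ext1 e
    change fj (g • e) = fk g * fj e * (fk g)⁻¹
    rw [h, mul_inv_cancel_right]

@[simp]
lemma edgesLift_j (fj : A.E →* K) (fk : A.G →* K) (h) (e : A.E) :
    edgesLift fj fk h (A.j e) = fj e := by simp [edgesLift, j]

@[simp]
lemma edgesLift_k (fj : A.E →* K) (fk : A.G →* K) (h) (g : A.G) :
    edgesLift fj fk h (A.k g) = fk g := by simp [edgesLift, k]

/-- Universal property of `L ⋊ E`. -/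
def secLift (fz : A.L →* K) (fp : A.E →* K)
    (hpz : ∀ e l, fp e * fz l = fz (A.sec e l) * fp e) : A.SecProd →* K :=
  SemidirectProduct.lift fz fp fun e => by
    ext1 l
    change fz (A.sec e l) = fp e * fz l * (fp e)⁻¹
    rw [hpz, mul_inv_cancel_right]

@[simp]
lemma secLift_inl (fz : A.L →* K) (fp : A.E →* K) (h) (l : A.L) :
    secLift fz fp h (inl l) = fz l := by
  rw [secLift, lift_inl]

@[simp]
lemma secLift_inr (fz : A.L →* K) (fp : A.E →* K) (h) (e : A.E) :
    secLift fz fp h (inr e) = fp e := by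
  rw [secLift, lift_inr]

/-- Universal property of the group of `2`-simplices. -/
def trianglesLift (fz : A.L →* K) (fp fq : A.E →* K) (fi : A.G →* K)
    (hpz : ∀ e l, fp e * fz l = fz (A.sec e l) * fp e)
    (hqz : ∀ e l, fq e * fz l = fz (A.sec e l) * fq e)
    (hqp : ∀ e f, fq e * fp f = fz (A.lift e f) * fp (A.bdry e • f) * fq e)
    (hiz : ∀ g l, fi g * fz l = fz (g • l) * fi g)
    (hip : ∀ g e, fi g * fp e = fp (g • e) * fi g)
    (hiq : ∀ g e, fi g * fq e = fq (g • e) * fi g) : A.Triangles →* K :=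
  SemidirectProduct.lift
    (secLift fz fp hpz)
    (edgesLift fq fi hiq) fun b => by
      suffices h : ∀ x : A.Edges, ∀ y : A.SecProd, secLift fz fp hpz
          (A.edgesAut x y) = edgesLift fq fi hiq x * secLift fz fp hpz y *
            (edgesLift fq fi hiq x)⁻¹ from MonoidHom.ext fun y => h b y
      intro x y
      obtain ⟨e, g⟩ := x
      obtain ⟨l, f⟩ := y
      have h1 : A.edgesAut ⟨e, g⟩ ⟨l, f⟩ =
          inl (A.sec e (g • l)) * (inl (A.lift e (g • f)) * inr (A.bdry e • g • f)) := by
        rw [mk_eq_inl_mul_inr, mk_eq_inl_mul_inr, map_mul A.edgesAut, edgesAut_inl,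
          edgesAut_inr, MulAut.mul_apply]
        simp
      have h2 : edgesLift fq fi hiq ⟨e, g⟩ = fq e * fi g := rfl
      have h3 : secLift fz fp hpz ⟨l, f⟩ = fz l * fp f := rfl
      rw [h1, h2, h3, map_mul, map_mul, eq_mul_inv_iff_mul_eq]
      simp only [secLift_inl, secLift_inr]
      calc _ = fz (A.sec e (g • l)) * (fz (A.lift e (g • f)) * fp (A.bdry e • g • f) * fq e) *
            fi g := by group
        _ = fz (A.sec e (g • l)) * fq e * (fp (g • f) * fi g) := by rw [← hqp]; group
        _ = fq e * (fz (g • l) * fi g) * fp f := by rw [← hqz, ← hip]; group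
        _ = _ := by rw [← hiz]; group

variable (fz : A.L →* K) (fp fq : A.E →* K) (fi : A.G →* K) (hpz) (hqz) (hqp) (hiz) (hip) (hiq)

@[simp]
lemma trianglesLift_z (l : A.L) :
    trianglesLift fz fp fq fi hpz hqz hqp hiz hip hiq (A.z l) = fz l := by
  rw [trianglesLift, z, MonoidHom.comp_apply, lift_inl, secLift_inl]

@[simp]
lemma trianglesLift_p (e : A.E) :
    trianglesLift fz fp fq fi hpz hqz hqp hiz hip hiq (A.p e) = fp e := by
  rw [trianglesLift, p, MonoidHom.comp_apply, lift_inl, secLift_inr]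

@[simp]
lemma trianglesLift_q (e : A.E) :
    trianglesLift fz fp fq fi hpz hqz hqp hiz hip hiq (A.q e) = fq e := by
  rw [trianglesLift, q, MonoidHom.comp_apply, lift_inr]
  exact edgesLift_j _ _ _ _

@[simp]
lemma trianglesLift_i (g : A.G) :
    trianglesLift fz fp fq fi hpz hqz hqp hiz hip hiq (A.i g) = fi g := by
  rw [trianglesLift, i, MonoidHom.comp_apply, lift_inr]
  exact edgesLift_k _ _ _ _

end Lift

end TwoCrossedModule

/-! ### Three-dimensional horn filling in a truncated simplicial group. -/

/-- A 2-truncated simplicial group in degrees one and two, in which the group of `0`-simplices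
is replaced by its degenerate image (`c₀ = s₀ d₀` and `c₁ = s₀ d₁`) and intersections of kernels of
faces satisfy the commutator conditions of a 2-type. -/
structure TruncatedSimplicialGroup (B H : Type*) [Group B] [Group H] where
  d₀ : H →* B
  d₁ : H →* B
  d₂ : H →* B
  s₀ : B →* H
  s₁ : B →* H
  c₀ : B →* B
  c₁ : B →* B
  d₀_s₀ : ∀ b, d₀ (s₀ b) = b
  d₁_s₀ : ∀ b, d₁ (s₀ b) = b
  d₂_s₀ : ∀ b, d₂ (s₀ b) = c₁ b
  d₀_s₁ : ∀ b, d₀ (s₁ b) = c₀ b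
  d₁_s₁ : ∀ b, d₁ (s₁ b) = b
  d₂_s₁ : ∀ b, d₂ (s₁ b) = b
  c₀_d₁ : ∀ h, c₀ (d₁ h) = c₀ (d₀ h)
  c₀_d₂ : ∀ h, c₀ (d₂ h) = c₁ (d₀ h)
  c₁_d₂ : ∀ h, c₁ (d₂ h) = c₁ (d₁ h)
  c₀_c₀ : ∀ b, c₀ (c₀ b) = c₀ b
  c₀_c₁ : ∀ b, c₀ (c₁ b) = c₁ b
  c₁_c₀ : ∀ b, c₁ (c₀ b) = c₀ b
  c₁_c₁ : ∀ b, c₁ (c₁ b) = c₁ b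
  s₀_c₀ : ∀ b, s₀ (c₀ b) = s₁ (c₀ b)
  s₀_c₁ : ∀ b, s₀ (c₁ b) = s₁ (c₁ b)
  comm₀₁ : ∀ {x y : H}, d₀ x = 1 → d₁ x = 1 → d₂ y = 1 → Commute x y
  comm₀₂ : ∀ {x y : H}, d₀ x = 1 → d₂ x = 1 → d₁ y = 1 → Commute x y
  comm₁₂ : ∀ {x y : H}, d₁ x = 1 → d₂ x = 1 → d₀ y = 1 → Commute x y

namespace TruncatedSimplicialGroup

variable {B H : Type*} [Group B] [Group H] (X : TruncatedSimplicialGroup B H)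

/-- The missing face of a 3-dimensional horn with faces `A`, `C` and `n`. -/
def fill (A C n : H) : H :=
  -- `A`, `C`, `n` are faces 0, 1, 3 of a 3-simplex, and the missing face is face 2. Moore's
  -- algorithm fills the horn by s₁(v) s₂(y) s₀(A), where y = n s₀(d₂A)⁻¹ and v = C A⁻¹ s₁(d₂A)
  -- s₁(d₁n)⁻¹; its face d₂ is v y s₀(d₁A).
  C * A⁻¹ * X.s₁ (X.d₂ A) * (X.s₁ (X.d₁ n))⁻¹ * n * (X.s₀ (X.d₂ A))⁻¹ * X.s₀ (X.d₁ A)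

/-- Compatibility of the faces of a horn. -/
structure IsHorn (A C n : H) : Prop where
  h₀ : X.d₀ A = X.d₀ C
  h₁ : X.d₂ A = X.d₀ n
  h₂ : X.d₂ C = X.d₁ n

variable {X}

lemma IsHorn.mul {A C n A' C' n' : H} (h : X.IsHorn A C n) (h' : X.IsHorn A' C' n') :
    X.IsHorn (A * A') (C * C') (n * n') :=
  ⟨by simp [h.h₀, h'.h₀], by simp [h.h₁, h'.h₁], by simp [h.h₂, h'.h₂]⟩

lemma IsHorn.inv {A C n : H} (h : X.IsHorn A C n) : X.IsHorn A⁻¹ C⁻¹ n⁻¹ :=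
  ⟨by simp [h.h₀], by simp [h.h₁], by simp [h.h₂]⟩

lemma IsHorn.c₀_eq {A C n : H} (h : X.IsHorn A C n) : X.c₀ (X.d₂ A) = X.c₀ (X.d₁ n) := by
  rw [X.c₀_d₂, ← h.h₂, X.c₀_d₂, h.h₀]

lemma IsHorn.d₀_fill {A C n : H} (h : X.IsHorn A C n) : X.d₀ (X.fill A C n) = X.d₁ A := by
  simp [fill, X.d₀_s₀, X.d₀_s₁, h.c₀_eq, h.h₀, h.h₁.symm]

lemma IsHorn.d₁_fill {A C n : H} (_ : X.IsHorn A C n) : X.d₁ (X.fill A C n) = X.d₁ C := by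
  simp [fill, X.d₁_s₀, X.d₁_s₁]

lemma IsHorn.d₂_fill {A C n : H} (h : X.IsHorn A C n) : X.d₂ (X.fill A C n) = X.d₂ n := by
  simp [fill, X.d₂_s₀, X.d₂_s₁, h.h₂, X.c₁_d₂]

/-- The conceptual reason is that horns in a 2-type have unique 3-dimensional fillers. In the
absence of 3-simplices, the two words are compared through four commutations, each between an
element of two face kernels and an element of the third. -/
lemma fill_mul {A C n A' C' n' : H} (h : X.IsHorn A C n) (h' : X.IsHorn A' C' n') :
    X.fill (A * A') (C * C') (n * n') = X.fill A C n * X.fill A' C' n' := by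
  obtain ⟨u, hu⟩ : ∃ u, X.d₂ A = u := ⟨_, rfl⟩
  obtain ⟨w, hw⟩ : ∃ w, X.d₁ n = w := ⟨_, rfl⟩
  obtain ⟨y, hy⟩ : ∃ y, X.d₁ A = y := ⟨_, rfl⟩
  obtain ⟨u', hu'⟩ : ∃ u, X.d₂ A' = u := ⟨_, rfl⟩
  obtain ⟨w', hw'⟩ : ∃ w, X.d₁ n' = w := ⟨_, rfl⟩
  obtain ⟨y', hy'⟩ : ∃ y, X.d₁ A' = y := ⟨_, rfl⟩
  have cuw : X.c₀ u = X.c₀ w := by rw [← hu, ← hw]; exact h.c₀_eq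
  have cuw' : X.c₀ u' = X.c₀ w' := by rw [← hu', ← hw']; exact h'.c₀_eq
  have cuy : X.c₁ u = X.c₁ y := by rw [← hu, ← hy]; exact X.c₁_d₂ A
  have n0 : X.d₀ n = u := by rw [← h.h₁, hu]
  have n0' : X.d₀ n' = u' := by rw [← h'.h₁, hu']
  have C2' : X.d₂ C' = w' := by rw [h'.h₂, hw']
  have e1 : Commute (C' * A'⁻¹ * X.s₁ u' * (X.s₁ w')⁻¹)
      (A⁻¹ * X.s₁ u * (X.s₁ w)⁻¹ * n * (X.s₀ u)⁻¹ * X.s₀ y) := by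
    apply X.comm₀₂
    · simp [X.d₀_s₁, cuw', h'.h₀]
    · simp [X.d₂_s₁, hu', C2']
    · simp [X.d₁_s₁, X.d₁_s₀, hw, hy]
  have e2 : Commute (X.s₁ u' * (X.s₁ w')⁻¹ * n' * (X.s₀ u')⁻¹) ((X.s₀ u)⁻¹ * X.s₀ y) := by
    apply X.comm₀₁
    · simp [X.d₀_s₀, X.d₀_s₁, cuw', n0']
    · simp [X.d₁_s₀, X.d₁_s₁, hw']
    · simp [X.d₂_s₀, cuy]
  have e3 : Commute (A⁻¹ * X.s₁ u * (X.s₀ u)⁻¹ * X.s₀ y) (X.s₁ u' * (X.s₁ w')⁻¹) := by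
    apply X.comm₁₂
    · simp [X.d₁_s₀, X.d₁_s₁, hy]
    · simp [X.d₂_s₀, X.d₂_s₁, hu, cuy]
    · simp [X.d₀_s₁, cuw']
  -- The first factor is a commutator of an element killed by d₀ with one killed by d₂, hence it is
  -- killed by both.
  have e4 : Commute ((X.s₁ u' * (X.s₁ w')⁻¹)⁻¹ * (A⁻¹ * X.s₁ u)⁻¹ * (X.s₁ u' * (X.s₁ w')⁻¹)
      * (A⁻¹ * X.s₁ u)) ((X.s₁ w)⁻¹ * n) := by
    apply X.comm₀₂
    · simp [X.d₀_s₁, cuw']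
    · simp [X.d₂_s₁, hu]
    · simp [X.d₁_s₁, hw]
  simp only [fill, map_mul, hu, hw, hy, hu', hw', hy']
  generalize X.s₁ u = a at *
  generalize X.s₁ w = b at *
  generalize X.s₁ u' = a' at *
  generalize X.s₁ w' = b' at *
  generalize X.s₀ u = c at *
  generalize X.s₀ y = d at *
  generalize X.s₀ u' = c' at *
  generalize X.s₀ y' = d' at *
  clear hu hw hy hu' hw' hy' cuw cuw' cuy n0 n0' C2' h h'
  obtain ⟨r, hr⟩ : ∃ r, a' * b'⁻¹ = r := ⟨_, rfl⟩
  obtain ⟨α, hα⟩ : ∃ α, A⁻¹ * a = α := ⟨_, rfl⟩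
  obtain ⟨β, hβ⟩ : ∃ β, b⁻¹ * n = β := ⟨_, rfl⟩
  obtain ⟨γ, hγ⟩ : ∃ γ, c⁻¹ * d = γ := ⟨_, rfl⟩
  obtain ⟨N, hN⟩ : ∃ N, r * n' * c'⁻¹ = N := ⟨_, rfl⟩
  have f1 : Commute (C' * A'⁻¹ * r) (α * β * γ) := by
    subst hr hα hβ hγ; simpa only [mul_assoc] using e1
  have f2 : Commute N γ := by subst hN hr hγ; simpa only [mul_assoc] using e2
  have f3 : Commute (α * γ) r := by subst hr hα hγ; simpa only [mul_assoc] using e3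
  have f4 : Commute (r⁻¹ * α⁻¹ * r * α) β := by rw [hr, hα, hβ] at e4; exact e4
  have f4' : r * α * β * α⁻¹ * r⁻¹ = α * r * β * r⁻¹ * α⁻¹ := by
    have : α * r * (r⁻¹ * α⁻¹ * r * α * β) * α⁻¹ * r⁻¹
      = α * r * (β * (r⁻¹ * α⁻¹ * r * α)) * α⁻¹ * r⁻¹ := by rw [f4.eq]
    simpa [mul_assoc] using this
  have key : r * (α * β * γ) * r⁻¹ = α * r * β * r⁻¹ * γ := by
    calc r * (α * β * γ) * r⁻¹ = r * α * β * α⁻¹ * ((α * γ) * r⁻¹) := by group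
      _ = (r * α * β * α⁻¹ * r⁻¹) * (α * γ) := by rw [(f3.inv_right).eq]; group
      _ = _ := by rw [f4']; group
  calc C * C' * (A * A')⁻¹ * (a * a') * (b * b')⁻¹ * (n * n') * (c * c')⁻¹ * (d * d')
      = C * (C' * A'⁻¹) * (α * r * β * r⁻¹ * (N * γ)) * d' := by
        subst hN hr hα hβ hγ; group
    _ = C * (C' * A'⁻¹) * (r * (α * β * γ) * r⁻¹ * N) * d' := by rw [f2.eq, key]; group
    _ = C * ((C' * A'⁻¹ * r) * (α * β * γ)) * r⁻¹ * N * d' := by group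
    _ = _ := by rw [f1.eq]; subst hN hr hα hβ hγ; group

lemma fill_inv {A C n : H} (h : X.IsHorn A C n) :
    X.fill A⁻¹ C⁻¹ n⁻¹ = (X.fill A C n)⁻¹ := by
  rw [eq_inv_iff_mul_eq_one, ← fill_mul h.inv h]
  simp [fill]

/-- This is the horn of the degenerate 3-simplex s₂ν, whose faces 2 and 3 are both ν. -/
lemma fill_s₁ (U W ν : H) {u w : B} (hU : U = X.s₁ u) (hW : W = X.s₁ w) (hν : X.d₁ ν = w) :
    X.fill U W ν = ν := by
  subst hU hW
  simp [fill, X.d₂_s₁, X.d₁_s₁, hν]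

/-- The equivariance condition for the top-dimensional component of a homotopy. -/
def IsEquivariantAt (X : TruncatedSimplicialGroup B H) (U : B) (T T' : H) (y y' : B) : Prop :=
  -- The prism over an element of E consists of the triangles T and s₁y, the prism over an element
  -- of G of s₁U and s₀U. Only the combination T s₁(y)⁻¹ is required to be compatible with
  -- conjugation: T' has d₁-face y', whereas s₁(U) T s₁(U)⁻¹ has U y U⁻¹.
  T' * (X.s₁ y')⁻¹ = X.s₁ U * T * (X.s₁ U)⁻¹ * (X.s₀ U * (X.s₁ y)⁻¹ * (X.s₀ U)⁻¹)

/-- Used to replace conjugation by ν with conjugation by the degenerate simplex s₁(d₂ν). First, ν⁻¹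
s₀(d₁ν) and s₁(d₂ν)⁻¹ s₀(d₂ν) conjugate s₁x alike, since they differ by an element killed by d₁ and
d₂ while d₀ kills s₁x. Then ν⁻¹ s₁(d₂ν), killed by d₂, commutes with the resulting element of ker d₀
∩ ker d₁. -/
lemma conj_s₁_mul_conj_s₀ (ν : H) {x : B} (hx : X.c₀ x = 1) :
    ν * X.s₁ x * ν⁻¹ * (X.s₀ (X.d₁ ν) * (X.s₁ x)⁻¹ * (X.s₀ (X.d₁ ν))⁻¹) =
      X.s₁ (X.d₂ ν) * X.s₁ x * (X.s₁ (X.d₂ ν))⁻¹ *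
        (X.s₀ (X.d₂ ν) * (X.s₁ x)⁻¹ * (X.s₀ (X.d₂ ν))⁻¹) := by
  obtain ⟨W, hW⟩ : ∃ W, X.d₁ ν = W := ⟨_, rfl⟩
  obtain ⟨V, hV⟩ : ∃ V, X.d₂ ν = V := ⟨_, rfl⟩
  have cVW : X.c₁ V = X.c₁ W := by rw [← hV, ← hW]; exact X.c₁_d₂ ν
  rw [hW, hV]
  have e1 : Commute (((X.s₁ V)⁻¹ * X.s₀ V)⁻¹ * (ν⁻¹ * X.s₀ W)) (X.s₁ x) := by
    apply X.comm₁₂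
    · simp [X.d₁_s₀, X.d₁_s₁, hW]
    · simp [X.d₂_s₀, X.d₂_s₁, hV, cVW]
    · simp [X.d₀_s₁, hx]
  have e2 : Commute (X.s₁ x * ((X.s₁ V)⁻¹ * X.s₀ V * (X.s₁ x)⁻¹ * ((X.s₁ V)⁻¹ * X.s₀ V)⁻¹))
      (ν⁻¹ * X.s₁ V) := by
    apply X.comm₀₁
    · simp [X.d₀_s₀, X.d₀_s₁, hx]
    · simp [X.d₁_s₀, X.d₁_s₁]
    · simp [X.d₂_s₁, hV]
  generalize X.s₁ x = x at *
  generalize X.s₁ V = a at *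
  generalize X.s₀ V = b at *
  generalize X.s₀ W = c at *
  have e1' : ν⁻¹ * c * x⁻¹ * (ν⁻¹ * c)⁻¹ = a⁻¹ * b * x⁻¹ * (a⁻¹ * b)⁻¹ := by
    have := e1.inv_right.eq
    calc ν⁻¹ * c * x⁻¹ * (ν⁻¹ * c)⁻¹
        = a⁻¹ * b * (((a⁻¹ * b)⁻¹ * (ν⁻¹ * c)) * x⁻¹) * (ν⁻¹ * c)⁻¹ := by group
      _ = _ := by rw [this]; group
  calc ν * x * ν⁻¹ * (c * x⁻¹ * c⁻¹) = ν * (x * (ν⁻¹ * c * x⁻¹ * (ν⁻¹ * c)⁻¹)) * ν⁻¹ := by group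
    _ = ν * ((x * (a⁻¹ * b * x⁻¹ * (a⁻¹ * b)⁻¹)) * (ν⁻¹ * a)) * a⁻¹ := by rw [e1']; group
    _ = _ := by rw [e2.eq]; group

/-- The analogue for (s₁y)⁻¹ s₀y, which is killed by d₁; the second factor on the left is the
correction coming from the face `A` in `fill_isEquivariantAt`. -/
lemma conj_s₁_inv_mul_s₀ (ν : H) {y : B} (hy : X.c₀ y = 1) :
    ν * ((X.s₁ y)⁻¹ * X.s₀ y) * ν⁻¹ *
      ((X.s₁ (X.c₁ (X.d₀ ν) * y * (X.c₁ (X.d₀ ν))⁻¹))⁻¹ *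
        (X.s₀ (X.d₀ ν) * X.s₁ y * (X.s₀ (X.d₀ ν))⁻¹) *
        (X.s₀ (X.d₀ ν) * (X.s₀ y)⁻¹ * (X.s₀ (X.d₀ ν))⁻¹) *
        X.s₀ (X.c₁ (X.d₀ ν) * y * (X.c₁ (X.d₀ ν))⁻¹)) =
      X.s₁ (X.d₂ ν) * ((X.s₁ y)⁻¹ * X.s₀ y) * (X.s₁ (X.d₂ ν))⁻¹ := by
  obtain ⟨U, hU⟩ : ∃ U, X.d₀ ν = U := ⟨_, rfl⟩
  obtain ⟨V, hV⟩ : ∃ V, X.d₂ ν = V := ⟨_, rfl⟩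
  have cUV : X.c₀ V = X.c₁ U := by rw [← hV, ← hU]; exact X.c₀_d₂ ν
  rw [hU, hV]
  obtain ⟨f, hf⟩ : ∃ f, X.c₁ U = f := ⟨_, rfl⟩
  have f0 : X.c₀ f = f := by rw [← hf]; exact X.c₀_c₁ U
  have f1 : X.c₁ f = f := by rw [← hf]; exact X.c₁_c₁ U
  have sf : X.s₀ f = X.s₁ f := by rw [← hf]; exact X.s₀_c₁ U
  rw [hf]
  rw [hf] at cUV
  have e1 : Commute ((X.s₁ f * (X.s₁ V)⁻¹) * (ν * (X.s₀ U)⁻¹))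
      (X.s₀ U * ((X.s₁ y)⁻¹ * X.s₀ y) * (X.s₀ U)⁻¹) := by
    apply X.comm₀₂
    · simp [X.d₀_s₀, X.d₀_s₁, hU, cUV, f0]
    · simp [X.d₂_s₀, X.d₂_s₁, hV, hf]
    · simp [X.d₁_s₀, X.d₁_s₁]
  have e2 : Commute ((X.s₁ (f * y * f⁻¹))⁻¹ * (X.s₀ U * X.s₁ y * (X.s₀ U)⁻¹) *
      (X.s₀ U * (X.s₀ y)⁻¹ * (X.s₀ U)⁻¹) * X.s₀ (f * y * f⁻¹)) (X.s₁ V * (X.s₁ f)⁻¹) := by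
    apply X.comm₁₂
    · simp [X.d₁_s₀, X.d₁_s₁]
      group
    · simp [X.d₂_s₀, X.d₂_s₁, hf, f1]
      group
    · simp [X.d₀_s₁, cUV, f0]
  have e3 : Commute ((X.s₁ (f * y * f⁻¹))⁻¹ * (X.s₀ U * X.s₁ y * (X.s₀ U)⁻¹))
      (X.s₀ U * ((X.s₁ y)⁻¹ * X.s₀ y) * (X.s₀ U)⁻¹) := by
    apply X.comm₀₂
    · simp [X.d₀_s₀, X.d₀_s₁, f0, hy]
    · simp [X.d₂_s₀, X.d₂_s₁, hf]
      group
    · simp [X.d₁_s₀, X.d₁_s₁]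
  simp only [map_mul, map_inv, sf] at *
  generalize X.s₁ y = p at *
  generalize X.s₀ y = q at *
  generalize X.s₁ V = a at *
  generalize X.s₀ U = b at *
  generalize X.s₁ f = c at *
  obtain ⟨ρ, hρ⟩ : ∃ ρ, a * c⁻¹ = ρ := ⟨_, rfl⟩
  obtain ⟨χ, hχ⟩ : ∃ χ, c * a⁻¹ * (ν * b⁻¹) = χ := ⟨_, rfl⟩
  obtain ⟨o, ho⟩ : ∃ o, b * (p⁻¹ * q) * b⁻¹ = o := ⟨_, rfl⟩
  rw [hχ, ho] at e1
  rw [hρ] at e2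
  rw [ho] at e3
  obtain ⟨k, hk⟩ : ∃ k, (c * p * c⁻¹)⁻¹ * (b * p * b⁻¹) = k := ⟨_, rfl⟩
  rw [hk] at e2 e3 ⊢
  have hν : ν = ρ * χ * b := by subst hρ hχ; group
  have ha : a = ρ * c := by subst hρ; group
  obtain ⟨m, hm⟩ : ∃ m, k * (b * q⁻¹ * b⁻¹) * (c * q * c⁻¹) = m := ⟨_, rfl⟩
  rw [hm] at e2 ⊢
  have ho' : o * m = c * (p⁻¹ * q) * c⁻¹ := by
    calc o * m = (k * o) * (b * q⁻¹ * b⁻¹) * (c * q * c⁻¹) := by rw [e3.eq, ← hm]; group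
      _ = _ := by subst ho hk; group
  calc ν * (p⁻¹ * q) * ν⁻¹ * m = ρ * (χ * o) * χ⁻¹ * ρ⁻¹ * m := by rw [hν, ← ho]; group
    _ = ρ * o * (ρ⁻¹ * m) := by rw [e1.eq]; group
    _ = ρ * (o * m) * ρ⁻¹ := by rw [← e2.inv_right.eq]; group
    _ = _ := by rw [ho', ha]; group

/-- Up to corrections κ in ker d₀ ∩ ker d₂, the horn (A', C', νnν⁻¹) is the conjugate of (A, C, n)
by the horn (s₁(d₀ν), s₁(d₁ν), ν), whose missing face is ν. By `fill_mul` its filler is therefore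
the conjugate by ν of the old one, times the filler of the corrections. The two preceding lemmas
then turn conjugation by ν into conjugation by s₁(d₂ν). -/
lemma fill_isEquivariantAt {A C n A' C' ν : H} (h : X.IsHorn A C n)
    {x y : B} (hx : X.d₁ C = x) (hy : X.d₁ A = y)
    (hx0 : X.c₀ x = 1) (hy0 : X.c₀ y = 1) (hUW : X.c₀ (X.d₀ ν) = X.c₀ (X.d₁ ν))
    (hA : X.IsEquivariantAt (X.d₀ ν) A A' y (X.c₁ (X.d₀ ν) * y * (X.c₁ (X.d₀ ν))⁻¹))
    (hC : X.IsEquivariantAt (X.d₁ ν) C C' x (X.c₁ (X.d₁ ν) * x * (X.c₁ (X.d₁ ν))⁻¹)) :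
    X.IsEquivariantAt (X.d₂ ν) (X.fill A C n) (X.fill A' C' (ν * n * ν⁻¹)) x
      (X.c₁ (X.d₂ ν) * x * (X.c₁ (X.d₂ ν))⁻¹) := by
  have hX := conj_s₁_mul_conj_s₀ (X := X) ν hx0
  have hY := conj_s₁_inv_mul_s₀ (X := X) ν hy0
  have cVW : X.c₁ (X.d₂ ν) = X.c₁ (X.d₁ ν) := X.c₁_d₂ ν
  have hν : X.IsHorn (X.s₁ (X.d₀ ν)) (X.s₁ (X.d₁ ν)) ν :=
    ⟨by simp [X.d₀_s₁, hUW], by simp [X.d₂_s₁], by simp [X.d₂_s₁]⟩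
  obtain ⟨κA, hκA⟩ : ∃ κ, X.s₀ (X.d₀ ν) * (X.s₁ y)⁻¹ * (X.s₀ (X.d₀ ν))⁻¹ *
    X.s₁ (X.c₁ (X.d₀ ν) * y * (X.c₁ (X.d₀ ν))⁻¹) = κ := ⟨_, rfl⟩
  obtain ⟨κC, hκC⟩ : ∃ κ, X.s₀ (X.d₁ ν) * (X.s₁ x)⁻¹ * (X.s₀ (X.d₁ ν))⁻¹ *
    X.s₁ (X.c₁ (X.d₁ ν) * x * (X.c₁ (X.d₁ ν))⁻¹) = κ := ⟨_, rfl⟩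
  obtain ⟨κB, hκB⟩ : ∃ κ, X.s₀ (X.d₂ ν) * (X.s₁ x)⁻¹ * (X.s₀ (X.d₂ ν))⁻¹ *
    X.s₁ (X.c₁ (X.d₁ ν) * x * (X.c₁ (X.d₁ ν))⁻¹) = κ := ⟨_, rfl⟩
  have κA0 : X.d₀ κA = 1 := by simp [← hκA, X.d₀_s₀, X.d₀_s₁, X.c₀_c₁, hy0]
  have κA2 : X.d₂ κA = 1 := by simp [← hκA, X.d₂_s₀, X.d₂_s₁]
  have κC0 : X.d₀ κC = 1 := by simp [← hκC, X.d₀_s₀, X.d₀_s₁, X.c₀_c₁, hx0]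
  have κC2 : X.d₂ κC = 1 := by simp [← hκC, X.d₂_s₀, X.d₂_s₁]
  have κB0 : X.d₀ κB = 1 := by simp [← hκB, X.d₀_s₀, X.d₀_s₁, X.c₀_c₁, hx0]
  have κB2 : X.d₂ κB = 1 := by simp [← hκB, X.d₂_s₀, X.d₂_s₁, cVW]
  have hκ : X.IsHorn κA κC 1 := ⟨by rw [κA0, κC0], by rw [κA2, map_one], by rw [κC2, map_one]⟩
  have hA' : A' = X.s₁ (X.d₀ ν) * A * (X.s₁ (X.d₀ ν))⁻¹ * κA := by
    rw [← hκA, ← mul_assoc, ← mul_inv_eq_iff_eq_mul, hA]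
  have hC' : C' = X.s₁ (X.d₁ ν) * C * (X.s₁ (X.d₁ ν))⁻¹ * κC := by
    rw [← hκC, ← mul_assoc, ← mul_inv_eq_iff_eq_mul, hC]
  have hfill : X.fill A' C' (ν * n * ν⁻¹) =
      ν * X.fill A C n * ν⁻¹ * (κC * κA⁻¹ * X.s₀ (X.d₁ κA)) := by
    have := fill_mul ((hν.mul h).mul hν.inv) hκ
    rw [mul_one, fill_mul (hν.mul h) hν.inv, fill_mul hν h, fill_inv hν,
      fill_s₁ _ _ ν rfl rfl rfl, ← hA', ← hC'] at this
    rw [this]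
    simp [fill, κA2]
  have hκAd : κA⁻¹ * X.s₀ (X.d₁ κA) =
      (X.s₁ (X.c₁ (X.d₀ ν) * y * (X.c₁ (X.d₀ ν))⁻¹))⁻¹ *
        (X.s₀ (X.d₀ ν) * X.s₁ y * (X.s₀ (X.d₀ ν))⁻¹) *
        (X.s₀ (X.d₀ ν) * (X.s₀ y)⁻¹ * (X.s₀ (X.d₀ ν))⁻¹) *
        X.s₀ (X.c₁ (X.d₀ ν) * y * (X.c₁ (X.d₀ ν))⁻¹) := by
    simp [← hκA, X.d₁_s₁, X.d₁_s₀, mul_assoc]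
  rw [← hκAd] at hY
  have B0 := h.d₀_fill
  have B1 := h.d₁_fill
  rw [hy] at B0
  rw [hx] at B1
  -- After division by s₁x (s₁y)⁻¹ s₀y, which has the same faces d₀ and d₁, the filler lies in ker
  -- d₀ ∩ ker d₁. There ν and s₁(d₂ν) act alike, because they have the same d₂.
  have e1 : Commute (X.fill A C n * (X.s₁ x * ((X.s₁ y)⁻¹ * X.s₀ y))⁻¹)
      ((X.s₁ (X.d₂ ν))⁻¹ * ν) := by
    apply X.comm₀₁
    · simp [B0, X.d₀_s₁, X.d₀_s₀, hx0, hy0]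
    · simp [B1, X.d₁_s₁, X.d₁_s₀]
    · simp [X.d₂_s₁]
  have e2 : Commute κC (ν * ((X.s₁ y)⁻¹ * X.s₀ y) * ν⁻¹) := by
    apply X.comm₀₂ κC0 κC2
    simp [X.d₁_s₁, X.d₁_s₀]
  have e3 : Commute κB (X.s₁ (X.d₂ ν) * ((X.s₁ y)⁻¹ * X.s₀ y) * (X.s₁ (X.d₂ ν))⁻¹) := by
    apply X.comm₀₂ κB0 κB2
    simp [X.d₁_s₁, X.d₁_s₀]
  unfold IsEquivariantAt
  rw [hfill, cVW, mul_assoc κC]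
  generalize X.s₁ (X.c₁ (X.d₁ ν) * x * (X.c₁ (X.d₁ ν))⁻¹) = r at *
  generalize κA⁻¹ * X.s₀ (X.d₁ κA) = k at *
  generalize (X.s₁ y)⁻¹ * X.s₀ y = o at *
  generalize X.s₁ x = p at *
  generalize X.s₁ (X.d₂ ν) = a at *
  generalize X.s₀ (X.d₂ ν) = b at *
  generalize X.s₀ (X.d₁ ν) = c at *
  obtain ⟨B', hB'⟩ : ∃ B', X.fill A C n * (p * o)⁻¹ = B' := ⟨_, rfl⟩
  rw [hB'] at e1
  rw [mul_inv_eq_iff_eq_mul] at hB'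
  rw [hB']
  clear hB' B0 B1 hfill
  have e1' : ν * B' * ν⁻¹ = a * B' * a⁻¹ := by
    calc ν * B' * ν⁻¹ = a * ((a⁻¹ * ν) * B') * ν⁻¹ := by group
      _ = _ := by rw [← e1.eq]; group
  have hX' : ν * p * ν⁻¹ * κC = a * p * a⁻¹ * κB := by
    rw [← hκC, ← hκB, ← mul_assoc, hX, mul_assoc]
  calc ν * (B' * (p * o)) * ν⁻¹ * (κC * k) * r⁻¹
      = (ν * B' * ν⁻¹) * (ν * p * ν⁻¹) * ((ν * o * ν⁻¹) * κC) * k * r⁻¹ := by group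
    _ = (a * B' * a⁻¹) * (ν * p * ν⁻¹ * κC) * (ν * o * ν⁻¹ * k) * r⁻¹ := by
      rw [← e2.eq, e1']; group
    _ = (a * B' * a⁻¹) * (a * p * a⁻¹) * (κB * (a * o * a⁻¹)) * r⁻¹ := by
      rw [hX', hY]; group
    _ = _ := by rw [e3.eq, ← hκB]; group

end TruncatedSimplicialGroup

/-! ### The truncated simplicial group of a 2-crossed module. -/

namespace TwoCrossedModule

variable (A : TwoCrossedModule.{u})

/-- The endpoint projection of a `1`-simplex, as a degenerate `1`-simplex. -/
def c₀ : A.Edges →* A.Edges := edgesLift 1 A.k (by simp)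

/-- The initial point projection of a `1`-simplex, as a degenerate `1`-simplex. -/
def c₁ : A.Edges →* A.Edges :=
  edgesLift (A.k.comp A.bdry) A.k fun g e => by
    simp [A.bdry_smul, ← map_mul]

@[simp] lemma c₀_j (e : A.E) : A.c₀ (A.j e) = 1 := by simp [c₀]
@[simp] lemma c₀_k (g : A.G) : A.c₀ (A.k g) = A.k g := by simp [c₀]
@[simp] lemma c₁_j (e : A.E) : A.c₁ (A.j e) = A.k (A.bdry e) := by simp [c₁]
@[simp] lemma c₁_k (g : A.G) : A.c₁ (A.k g) = A.k g := by simp [c₁]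

/-- The degeneracy `s₀`. -/
def s₀ : A.Edges →* A.Triangles := edgesLift A.q A.i A.i_mul_q

/-- The degeneracy `s₁`. -/
def s₁ : A.Edges →* A.Triangles := edgesLift A.p A.i A.i_mul_p

@[simp] lemma s₀_j (e : A.E) : A.s₀ (A.j e) = A.q e := by simp [s₀]
@[simp] lemma s₀_k (g : A.G) : A.s₀ (A.k g) = A.i g := by simp [s₀]
@[simp] lemma s₁_j (e : A.E) : A.s₁ (A.j e) = A.p e := by simp [s₁]
@[simp] lemma s₁_k (g : A.G) : A.s₁ (A.k g) = A.i g := by simp [s₁]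

lemma j_mul_j (e f : A.E) :
    A.j e * A.j f = A.j (A.delta (A.lift e f)) * A.j (A.bdry e • f) * A.j e := by
  rw [← map_mul, ← map_mul, ← map_mul, delta_lift', smul_inv']
  congr 1
  group

/-- The face `d₀`. -/
def d₀ : A.Triangles →* A.Edges :=
  trianglesLift 1 1 A.j A.k (by simp) (by simp) (by simp) (by simp) (by simp) A.k_mul_j

/-- The face `d₁`. -/
def d₁ : A.Triangles →* A.Edges :=
  trianglesLift (A.j.comp A.delta) A.j A.j A.k
    (fun e l => by simp [← map_mul, delta_sec])
    (fun e l => by simp [← map_mul, delta_sec])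
    A.j_mul_j (fun g l => by simp [k_mul_j, A.delta_smul]) A.k_mul_j A.k_mul_j

/-- The face `d₂`. -/
def d₂ : A.Triangles →* A.Edges :=
  trianglesLift 1 A.j (A.k.comp A.bdry) A.k (by simp) (by simp) (by simp [k_mul_j]) (by simp)
    A.k_mul_j (fun g e => by simp [A.bdry_smul, ← map_mul])

@[simp] lemma d₀_z (l : A.L) : A.d₀ (A.z l) = 1 := by simp [d₀]
@[simp] lemma d₀_p (e : A.E) : A.d₀ (A.p e) = 1 := by simp [d₀]
@[simp] lemma d₀_q (e : A.E) : A.d₀ (A.q e) = A.j e := by simp [d₀]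
@[simp] lemma d₀_i (g : A.G) : A.d₀ (A.i g) = A.k g := by simp [d₀]
@[simp] lemma d₁_z (l : A.L) : A.d₁ (A.z l) = A.j (A.delta l) := by simp [d₁]
@[simp] lemma d₁_p (e : A.E) : A.d₁ (A.p e) = A.j e := by simp [d₁]
@[simp] lemma d₁_q (e : A.E) : A.d₁ (A.q e) = A.j e := by simp [d₁]
@[simp] lemma d₁_i (g : A.G) : A.d₁ (A.i g) = A.k g := by simp [d₁]
@[simp] lemma d₂_z (l : A.L) : A.d₂ (A.z l) = 1 := by simp [d₂]
@[simp] lemma d₂_p (e : A.E) : A.d₂ (A.p e) = A.j e := by simp [d₂]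
@[simp] lemma d₂_q (e : A.E) : A.d₂ (A.q e) = A.k (A.bdry e) := by simp [d₂]
@[simp] lemma d₂_i (g : A.G) : A.d₂ (A.i g) = A.k g := by simp [d₂]

/-- The action of the group of `1`-simplices on `L`. -/
def edgesAct : A.Edges →* MulAut A.L :=
  edgesLift A.secAut (MulDistribMulAction.toMulAut A.G A.L) fun g e => by
    ext l
    simp [smul_sec]

@[simp] lemma edgesAct_j (e : A.E) (l : A.L) : A.edgesAct (A.j e) l = A.sec e l := by
  simp [edgesAct]

@[simp] lemma edgesAct_k (g : A.G) (l : A.L) : A.edgesAct (A.k g) l = g • l := by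
  simp [edgesAct]

variable {A} in
/-- A homomorphism on the group of `2`-simplices that intertwines an action of this group on `L`
with conjugation may be tested on generators. -/
lemma conj_eq_of_generators {x : A.L → A.Triangles} (F : A.Triangles →* MulAut A.L)
    (hz : ∀ k l, A.z k * x l = x (F (A.z k) l) * A.z k)
    (hp : ∀ e l, A.p e * x l = x (F (A.p e) l) * A.p e)
    (hq : ∀ e l, A.q e * x l = x (F (A.q e) l) * A.q e)
    (hi : ∀ g l, A.i g * x l = x (F (A.i g) l) * A.i g) (h : A.Triangles) (l : A.L) :
    h * x l = x (F h l) * h := by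
  rw [A.triangle_eq h]
  generalize h.left.left = k
  generalize h.left.right = e
  generalize h.right.left = f
  generalize h.right.right = g
  simp only [map_mul, MulAut.mul_apply]
  rw [mul_assoc, hi, ← mul_assoc, mul_assoc _ (A.q f), hq, ← mul_assoc, mul_assoc _ (A.p e), hp,
    ← mul_assoc, hz]
  simp only [mul_assoc]

/-- The elements `z l` form ker d₀ ∩ ker d₂, and a 2-simplex acts on them by conjugation through the
remaining face d₁. The analogues `mul_z₀₁` and `mul_z₁₂` act through d₂ and d₀. The commutator
conditions of `nerve` follow at once: a simplex whose remaining face is trivial acts trivially. -/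
lemma mul_z (h : A.Triangles) (l : A.L) : h * A.z l = A.z (A.edgesAct (A.d₁ h) l) * h :=
  conj_eq_of_generators (A.edgesAct.comp A.d₁)
    (fun k l => by simp [sec_delta]) (fun e l => by simp [p_mul_z])
    (fun e l => by simp [q_mul_z]) (fun g l => by simp [i_mul_z]) h l

/-- The simplices with trivial faces `d₀` and `d₁`. -/
def z₀₁ (l : A.L) : A.Triangles := A.p (A.delta l) * (A.z l)⁻¹

/-- The simplices with trivial faces `d₁` and `d₂`. -/
def z₁₂ (l : A.L) : A.Triangles := A.q (A.delta l) * (A.z l)⁻¹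

lemma z_mul_z₀₁ (k l : A.L) : A.z k * A.z₀₁ l = A.z₀₁ l * A.z k := by
  have h1 : A.z₀₁ l * A.z k = A.z (k * l⁻¹) * A.p (A.delta l) := by
    rw [z₀₁, mul_assoc, ← map_inv, ← map_mul, p_mul_z, sec_delta]
    congr 2
    group
  have h2 : A.z₀₁ l = A.z l⁻¹ * A.p (A.delta l) := by
    rw [z₀₁, ← map_inv, p_mul_z, sec_delta]
    congr 2
    group
  rw [h1, h2, map_mul, mul_assoc]

lemma mul_z₀₁ (h : A.Triangles) (l : A.L) :
    h * A.z₀₁ l = A.z₀₁ (A.edgesAct (A.d₂ h) l) * h := by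
  refine conj_eq_of_generators (A.edgesAct.comp A.d₂) (fun k l => ?_) (fun e l => ?_)
    (fun e l => ?_) (fun g l => ?_) h l
  · simp [z_mul_z₀₁]
  · simp only [MonoidHom.comp_apply, d₂_p, edgesAct_j]
    rw [z₀₁, z₀₁, mul_assoc _ _ (A.p e), ← map_inv, ← map_inv, ← sec_inv, ← p_mul_z, delta_sec]
    simp only [map_mul, map_inv]
    group
  · simp only [MonoidHom.comp_apply, d₂_q, edgesAct_k]
    have hl : A.lift e (A.delta l) = A.sec e l * (A.bdry e • l)⁻¹ := by
      rw [eq_mul_inv_iff_mul_eq, ← sec_inv_inv, sec_inv, inv_inv]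
    have hz := A.z_mul_z₀₁ (A.sec e l) (A.bdry e • l)
    have hz' := A.z_mul_z₀₁ (A.bdry e • l) (A.bdry e • l)
    have h1 : (A.z (A.bdry e • l))⁻¹ * A.p (A.delta (A.bdry e • l)) = A.z₀₁ (A.bdry e • l) := by
      rw [inv_mul_eq_iff_eq_mul, hz', z₀₁, inv_mul_cancel_right]
    calc A.q e * A.z₀₁ l = (A.q e * A.p (A.delta l)) * A.z l⁻¹ := by
          rw [z₀₁, map_inv, mul_assoc]
      _ = A.z (A.sec e l) * ((A.z (A.bdry e • l))⁻¹ * A.p (A.delta (A.bdry e • l))) *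
            (A.q e * A.z l⁻¹) := by
          rw [q_mul_p, hl, A.delta_smul, map_mul, map_inv]; group
      _ = A.z₀₁ (A.bdry e • l) * A.q e := by
          rw [h1, hz, q_mul_z, sec_inv, map_inv]; group
  · simp only [MonoidHom.comp_apply, d₂_i, edgesAct_k]
    rw [z₀₁, z₀₁, mul_assoc _ _ (A.i g), ← map_inv, ← map_inv, ← smul_inv', ← i_mul_z,
      A.delta_smul, ← mul_assoc, i_mul_p, mul_assoc]

lemma mul_z₁₂ (h : A.Triangles) (l : A.L) :
    h * A.z₁₂ l = A.z₁₂ (A.edgesAct (A.d₀ h) l) * h := by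
  have hq : ∀ l, A.z₁₂ l = A.z l⁻¹ * A.q (A.delta l) := by
    intro l
    rw [z₁₂, ← map_inv, q_mul_z, sec_delta]
    congr 2
    group
  refine conj_eq_of_generators (A.edgesAct.comp A.d₀) (fun k l => ?_) (fun e l => ?_)
    (fun e l => ?_) (fun g l => ?_) h l
  · have h1 : A.z₁₂ l * A.z k = A.z (k * l⁻¹) * A.q (A.delta l) := by
      rw [z₁₂, mul_assoc, ← map_inv, ← map_mul, q_mul_z, sec_delta]
      congr 2
      group
    simp only [MonoidHom.comp_apply, d₀_z, map_one, MulAut.one_apply]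
    rw [h1, hq, map_mul, mul_assoc]
  · simp only [MonoidHom.comp_apply, d₀_p, map_one, MulAut.one_apply]
    have hl : A.lift (A.delta l) e = l * (A.sec e l)⁻¹ := by
      rw [← sec_inv, sec_def, map_inv, inv_inv]; group
    calc A.p e * A.z₁₂ l = (A.z (A.sec e l))⁻¹ * (A.p e * A.q (A.delta l)) := by
          rw [hq, ← mul_assoc, p_mul_z, sec_inv, map_inv, mul_assoc]
      _ = A.z l⁻¹ * A.z (A.lift (A.delta l) e) * A.p (A.bdry (A.delta l) • e) *
            A.q (A.delta l) := by
          rw [A.bdry_delta, one_smul, ← map_mul, hl, ← map_inv, inv_mul_cancel_left, mul_assoc]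
      _ = A.z₁₂ l * A.p e := by rw [hq, mul_assoc _ (A.q _), q_mul_p]; group
  · simp only [MonoidHom.comp_apply, d₀_q, edgesAct_j]
    rw [z₁₂, z₁₂, mul_assoc _ _ (A.q e), ← map_inv, ← map_inv, ← sec_inv, ← q_mul_z, delta_sec]
    simp only [map_mul, map_inv]
    group
  · simp only [MonoidHom.comp_apply, d₀_i, edgesAct_k]
    rw [z₁₂, z₁₂, mul_assoc _ _ (A.i g), ← map_inv, ← map_inv, ← smul_inv', ← i_mul_z,
      A.delta_smul, ← mul_assoc, i_mul_q, mul_assoc]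

lemma j_mul_k_eq_one {e : A.E} {g : A.G} (h : A.j e * A.k g = 1) : e = 1 ∧ g = 1 := by
  have h1 := congrArg SemidirectProduct.left h
  have h2 := congrArg SemidirectProduct.right h
  simpa [j, k] using And.intro h1 h2

lemma eq_z_of_faces {h : A.Triangles} (h0 : A.d₀ h = 1) (h2 : A.d₂ h = 1) :
    ∃ l, h = A.z l := by
  have H := A.triangle_eq h
  generalize h.left.left = l at H
  generalize h.left.right = e at H
  generalize h.right.left = f at H
  generalize h.right.right = g at H
  subst H
  simp only [map_mul, d₀_z, d₀_p, d₀_q, d₀_i, one_mul] at h0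
  obtain ⟨rfl, rfl⟩ := A.j_mul_k_eq_one h0
  simp only [map_mul, d₂_z, d₂_p, map_one, one_mul, mul_one] at h2
  obtain ⟨rfl, -⟩ := A.j_mul_k_eq_one (e := e) (g := 1) (by rw [h2, map_one, one_mul])
  exact ⟨l, by simp⟩

lemma eq_z₀₁_of_faces {h : A.Triangles} (h0 : A.d₀ h = 1) (h1 : A.d₁ h = 1) :
    ∃ l, h = (A.z₀₁ l)⁻¹ := by
  have H := A.triangle_eq h
  generalize h.left.left = l at H
  generalize h.left.right = e at H
  generalize h.right.left = f at H
  generalize h.right.right = g at H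
  subst H
  simp only [map_mul, d₀_z, d₀_p, d₀_q, d₀_i, one_mul] at h0
  obtain ⟨rfl, rfl⟩ := A.j_mul_k_eq_one h0
  simp only [map_mul, d₁_z, d₁_p, map_one, mul_one] at h1
  obtain ⟨h, -⟩ := A.j_mul_k_eq_one (e := A.delta l * e) (g := 1) (by
    rw [map_mul, h1, map_one, one_mul])
  rw [mul_eq_one_iff_eq_inv'] at h
  subst h
  exact ⟨l, by simp [z₀₁]⟩

lemma eq_z₁₂_of_faces {h : A.Triangles} (h1 : A.d₁ h = 1) (h2 : A.d₂ h = 1) :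
    ∃ l, h = (A.z₁₂ l)⁻¹ := by
  have H := A.triangle_eq h
  generalize h.left.left = l at H
  generalize h.left.right = e at H
  generalize h.right.left = f at H
  generalize h.right.right = g at H
  subst H
  simp only [map_mul, d₂_z, d₂_p, d₂_q, d₂_i, one_mul, mul_assoc] at h2
  obtain ⟨rfl, -⟩ := A.j_mul_k_eq_one (e := e) (g := A.bdry f * g) (by rw [map_mul, h2])
  simp only [map_mul, d₁_z, d₁_q, d₁_i, map_one, mul_one] at h1
  obtain ⟨h, rfl⟩ := A.j_mul_k_eq_one (e := A.delta l * f) (g := g) (by rw [map_mul, h1])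
  rw [mul_eq_one_iff_eq_inv'] at h
  subst h
  exact ⟨l, by simp [z₁₂]⟩

/-- The truncated simplicial group of a 2-crossed module. -/
def nerve : TruncatedSimplicialGroup A.Edges A.Triangles where
  d₀ := A.d₀
  d₁ := A.d₁
  d₂ := A.d₂
  s₀ := A.s₀
  s₁ := A.s₁
  c₀ := A.c₀
  c₁ := A.c₁
  d₀_s₀ := DFunLike.congr_fun (f := A.d₀.comp A.s₀) (g := MonoidHom.id _)
    (edges_hom_ext (by simp) (by simp))
  d₁_s₀ := DFunLike.congr_fun (f := A.d₁.comp A.s₀) (g := MonoidHom.id _)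
    (edges_hom_ext (by simp) (by simp))
  d₂_s₀ := DFunLike.congr_fun (f := A.d₂.comp A.s₀) (edges_hom_ext (by simp) (by simp))
  d₀_s₁ := DFunLike.congr_fun (f := A.d₀.comp A.s₁) (edges_hom_ext (by simp) (by simp))
  d₁_s₁ := DFunLike.congr_fun (f := A.d₁.comp A.s₁) (g := MonoidHom.id _)
    (edges_hom_ext (by simp) (by simp))
  d₂_s₁ := DFunLike.congr_fun (f := A.d₂.comp A.s₁) (g := MonoidHom.id _)
    (edges_hom_ext (by simp) (by simp))
  c₀_d₁ := DFunLike.congr_fun (f := A.c₀.comp A.d₁) (g := A.c₀.comp A.d₀)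
    (triangles_hom_ext (by simp) (by simp) (by simp) (by simp))
  c₀_d₂ := DFunLike.congr_fun (f := A.c₀.comp A.d₂) (g := A.c₁.comp A.d₀)
    (triangles_hom_ext (by simp) (by simp) (by simp) (by simp))
  c₁_d₂ := DFunLike.congr_fun (f := A.c₁.comp A.d₂) (g := A.c₁.comp A.d₁)
    (triangles_hom_ext (by simp [A.bdry_delta]) (by simp) (by simp) (by simp))
  c₀_c₀ := DFunLike.congr_fun (f := A.c₀.comp A.c₀) (edges_hom_ext (by simp) (by simp))
  c₀_c₁ := DFunLike.congr_fun (f := A.c₀.comp A.c₁) (edges_hom_ext (by simp) (by simp))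
  c₁_c₀ := DFunLike.congr_fun (f := A.c₁.comp A.c₀) (edges_hom_ext (by simp) (by simp))
  c₁_c₁ := DFunLike.congr_fun (f := A.c₁.comp A.c₁) (edges_hom_ext (by simp) (by simp))
  s₀_c₀ := DFunLike.congr_fun (f := A.s₀.comp A.c₀) (g := A.s₁.comp A.c₀)
    (edges_hom_ext (by simp) (by simp))
  s₀_c₁ := DFunLike.congr_fun (f := A.s₀.comp A.c₁) (g := A.s₁.comp A.c₁)
    (edges_hom_ext (by simp) (by simp))
  comm₀₁ {x y} h0 h1 h2 := by
    obtain ⟨l, rfl⟩ := A.eq_z₀₁_of_faces h0 h1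
    have h := A.mul_z₀₁ y l
    rw [h2, map_one, MulAut.one_apply] at h
    exact (Commute.inv_left h.symm)
  comm₀₂ {x y} h0 h2 h1 := by
    obtain ⟨l, rfl⟩ := A.eq_z_of_faces h0 h2
    have h := A.mul_z y l
    rw [h1, map_one, MulAut.one_apply] at h
    exact h.symm
  comm₁₂ {x y} h1 h2 h0 := by
    obtain ⟨l, rfl⟩ := A.eq_z₁₂_of_faces h1 h2
    have h := A.mul_z₁₂ y l
    rw [h0, map_one, MulAut.one_apply] at h
    exact (Commute.inv_left h.symm)

end TwoCrossedModule

namespace TwoCrossedModule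

/-! ### Derivation identities read as identities between 2-simplices. -/

section Triangles

variable (B : TwoCrossedModule.{u})

/-- Together with the next lemmas this expresses all operations of the 2-crossed module by
conjugation in one group, where identities reduce to word problems. -/
lemma z_lift (e f : B.E) :
    B.z (B.lift e f) = B.q e * B.p f * (B.q e)⁻¹ * (B.p (B.bdry e • f))⁻¹ := by
  rw [q_mul_p]; group

lemma z_sec_p (e : B.E) (l : B.L) : B.z (B.sec e l) = B.p e * B.z l * (B.p e)⁻¹ := by
  rw [p_mul_z]; group

lemma z_sec_q (e : B.E) (l : B.L) : B.z (B.sec e l) = B.q e * B.z l * (B.q e)⁻¹ := by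
  rw [q_mul_z]; group

lemma z_smul (g : B.G) (l : B.L) : B.z (g • l) = B.i g * B.z l * (B.i g)⁻¹ := by
  rw [i_mul_z]; group

lemma p_smul (g : B.G) (e : B.E) : B.p (g • e) = B.i g * B.p e * (B.i g)⁻¹ := by
  rw [i_mul_p]; group

lemma q_smul (g : B.G) (e : B.E) : B.q (g • e) = B.i g * B.q e * (B.i g)⁻¹ := by
  rw [i_mul_q]; group

lemma j_smul (g : B.G) (e : B.E) : B.j (g • e) = B.k g * B.j e * (B.k g)⁻¹ := by
  rw [k_mul_j]; group

lemma j_injective : Function.Injective B.j := SemidirectProduct.inl_injective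

lemma k_injective : Function.Injective B.k := SemidirectProduct.inr_injective

/-- The `2`-simplex with first edge `a`, second edge starting at `∂ a` and parallel to `x`, and
interior `t`. -/
def triangle (a x : B.E) (t : B.L) : B.Triangles := B.q a * B.p x * B.z t

variable {B} in
lemma triangle_injective {a x : B.E} {t t' : B.L} (h : B.triangle a x t = B.triangle a x t') :
    t = t' :=
  B.z_injective (mul_left_cancel h)

/-- The interior of the product is the right-hand side of the formula for t(ab) in a quadratic
derivation. -/
lemma triangle_mul (a b x y : B.E) (k l : B.L) :
    B.triangle a x k * B.triangle b y l =
      B.triangle (a * b) (((B.bdry b)⁻¹ • x) * y)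
        (B.sec (b * y)⁻¹ (B.lift b ((B.bdry b)⁻¹ • x⁻¹) * k) * l) := by
  rw [mul_inv_rev, sec_mul]
  simp only [triangle, map_mul, z_sec_p _ y⁻¹, z_sec_q _ b⁻¹, z_lift, smul_inv_smul, map_inv,
    smul_inv']
  group

-- The simplex q(a) p(x) already has the prescribed faces d₀ and d₂, so the quotient lies in ker d₀
-- ∩ ker d₂, the image of L.
variable {B} in
lemma eq_triangle {h : B.Triangles} {a x : B.E} (h0 : B.d₀ h = B.j a)
    (h2 : B.d₂ h = B.k (B.bdry a) * B.j x) : ∃ t, h = B.triangle a x t := by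
  obtain ⟨t, ht⟩ := B.eq_z_of_faces (h := (B.q a * B.p x)⁻¹ * h) (by simp [h0]) (by simp [h2])
  exact ⟨t, by rw [triangle, ← ht, mul_inv_cancel_left]⟩

/-- The interior of the second triangle is the right-hand side of the formula for t(g ▷ a). Besides
the conjugation rules, two facts enter: an element of ker d₀ ∩ ker d₁ commutes with one of ker d₂,
and p(e) and q(e) act alike on L. -/
lemma isEquivariantAt_triangle (g : B.G) (e a x : B.E) (t : B.L) :
    B.nerve.IsEquivariantAt (B.k g * B.j e) (B.triangle a x t)
      (B.triangle (g • a) (g • (((B.bdry a)⁻¹ • e) * x * e⁻¹))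
        ((g • B.sec (e * x⁻¹) (B.lift a⁻¹ e⁻¹)⁻¹) * (g • B.lift e (x⁻¹ * a⁻¹)) *
          ((g * B.bdry e) • t)))
      (B.j (a * x * B.delta t)) (B.j ((g * B.bdry e) • (a * x * B.delta t))) := by
  have e1 : Commute ((B.z t)⁻¹ * B.p (B.delta t))
      ((B.p (a * x * B.delta t))⁻¹ * ((B.q e)⁻¹ * B.i (B.bdry e)) *
        B.p (a * x * B.delta t)) := by
    apply B.nerve.comm₀₁
    · change B.d₀ _ = 1
      simp
    · change B.d₁ _ = 1
      simp
    · change B.d₂ _ = 1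
      simp
      group
  have e2 : B.q e * B.z t * (B.q e)⁻¹ = B.p e * B.z t * (B.p e)⁻¹ := by
    rw [← z_sec_q, ← z_sec_p]
  change _ * (B.s₁ _)⁻¹ = B.s₁ _ * _ * (B.s₁ _)⁻¹ * (B.s₀ _ * (B.s₁ _)⁻¹ * (B.s₀ _)⁻¹)
  simp only [triangle, map_mul, z_sec_p, z_lift, map_inv, smul_inv', z_smul, p_smul, q_smul,
    s₀_j, s₁_j, s₀_k, s₁_k, mul_inv_rev, inv_inv, j_smul] at *
  generalize B.i g = g at *
  generalize B.p e = pe at *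
  generalize B.q e = qe at *
  generalize B.i (B.bdry e) = i at *
  generalize B.p a = pa at *
  generalize B.q a = qa at *
  generalize B.p x = px at *
  generalize B.p (B.delta t) = d at *
  generalize B.z t = z at *
  generalize B.i (B.bdry a) = ia at *
  have e3 : z * d⁻¹ * px⁻¹ * pa⁻¹ * qe⁻¹ * i = px⁻¹ * pa⁻¹ * qe⁻¹ * i * pa * px * z * d⁻¹ *
      px⁻¹ * pa⁻¹ := by
    calc z * d⁻¹ * px⁻¹ * pa⁻¹ * qe⁻¹ * i = z * ((d⁻¹ * (px⁻¹ * pa⁻¹) * (qe⁻¹ * i) *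
          (pa * px * d)) * (z⁻¹ * d)) * d⁻¹ * z * d⁻¹ * px⁻¹ * pa⁻¹ := by group
      _ = _ := by rw [← e1.eq]; group
  have e4 : z * pe⁻¹ * qe = pe⁻¹ * qe * z := by
    calc z * pe⁻¹ * qe = pe⁻¹ * (pe * z * pe⁻¹) * qe := by group
      _ = _ := by rw [← e2]; group
  calc _ = g * pe * qa * px * (pe⁻¹ * qe) * (px⁻¹ * pa⁻¹ * qe⁻¹ * i * pa * px * z * d⁻¹ *
        px⁻¹ * pa⁻¹) * i⁻¹ * g⁻¹ := by group
    _ = g * pe * qa * px * (pe⁻¹ * qe * z) * d⁻¹ * px⁻¹ * pa⁻¹ * qe⁻¹ * g⁻¹ := by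
      rw [← e3]; group
    _ = _ := by rw [← e4]; group

end Triangles

/-! ### Homotopies as homomorphisms into simplices, and their composition. -/

section Homotopies

variable {A B : TwoCrossedModule.{u}}

/-- A homotopy of 2-crossed module maps, encoded by homomorphisms to the groups of `1`-simplices
and of `2`-simplices of the target. -/
structure SimplicialHomotopy (f f' : A ⟶ B) where
  edge : A.G →* B.Edges
  tri : A.E →* B.Triangles
  c₀_edge : ∀ g, B.c₀ (edge g) = B.k (f.φ g)
  c₁_edge : ∀ g, B.c₁ (edge g) = B.k (f'.φ g)
  d₀_tri : ∀ a, B.d₀ (tri a) = B.j (f.ψ a)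
  d₁_tri : ∀ a, B.d₁ (tri a) = B.j (f'.ψ a)
  d₂_tri : ∀ a, B.d₂ (tri a) = edge (A.bdry a)
  equivariant : ∀ g a, B.nerve.IsEquivariantAt (edge g) (tri a) (tri (g • a))
    (B.j (f'.ψ a)) (B.j (f'.ψ (g • a)))
  tri_delta : ∀ l, tri (A.delta l) =
    B.q (B.delta (f.μ l)) * (B.z (f.μ l))⁻¹ * B.z (f'.μ l)

lemma QuadraticDerivation.s_one {f : A ⟶ B} (D : QuadraticDerivation f) : D.s 1 = 1 := by
  have h := D.s_mul 1 1
  simpa using h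

/-- The homomorphism to the group of `1`-simplices defined by a quadratic derivation. -/
def QuadraticDerivation.edge {f : A ⟶ B} (D : QuadraticDerivation f) : A.G →* B.Edges :=
  MonoidHom.mk' (fun g => B.k (f.φ g) * B.j (D.s g)) fun g h => by
    rw [D.s_mul, map_mul, map_mul, map_mul, j_smul, map_inv]
    group

lemma QuadraticDerivation.edge_apply {f : A ⟶ B} (D : QuadraticDerivation f) (g : A.G) :
    D.edge g = B.k (f.φ g) * B.j (D.s g) := rfl

/-- Multiplicativity of `edge` alone forces this; it matches the second coordinate of the triangle
in `isEquivariantAt_triangle`. -/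
lemma s_smul_of_edge (f : A ⟶ B) {edge : A.G →* B.Edges} {s : A.G → B.E}
    (hs : ∀ g, edge g = B.k (f.φ g) * B.j (s g)) (g : A.G) (a : A.E) :
    s (A.bdry (g • a)) =
      f.φ g • (((B.bdry (f.ψ a))⁻¹ • s g) * s (A.bdry a) * (s g)⁻¹) := by
  have h : ∀ g, B.j (s g) = (B.k (f.φ g))⁻¹ * edge g := fun g => by
    rw [hs, inv_mul_cancel_left]
  apply B.j_injective
  simp only [A.bdry_smul, map_mul, map_inv, j_smul, smul_mul', f.bdry_comm, smul_inv', h]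
  group

/-- The encoding of a homotopy by simplices. -/
def Homotopy.toSimplicial {f f' : A ⟶ B} (H : Homotopy f f') : SimplicialHomotopy f f' where
  edge := H.edge
  tri := MonoidHom.mk' (fun a => B.triangle (f.ψ a) (H.s (A.bdry a)) (H.t a)) fun a b => by
    rw [triangle_mul, H.t_mul, map_mul, map_mul, H.s_mul, f.bdry_comm, map_inv]
  c₀_edge g := by simp [QuadraticDerivation.edge_apply]
  c₁_edge g := by simp [QuadraticDerivation.edge_apply, H.φ_eq]
  d₀_tri a := by simp [triangle]
  d₁_tri a := by simp [triangle, H.ψ_eq]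
  d₂_tri a := by simp [triangle, QuadraticDerivation.edge_apply, f.bdry_comm]
  equivariant g a := by
    change B.nerve.IsEquivariantAt (B.k (f.φ g) * B.j (H.s g))
      (B.triangle (f.ψ a) (H.s (A.bdry a)) (H.t a))
      (B.triangle (f.ψ (g • a)) (H.s (A.bdry (g • a))) (H.t (g • a))) _ _
    rw [f'.map_smul_E, H.t_smul, f.map_smul_E, s_smul_of_edge f H.edge_apply, H.ψ_eq, H.φ_eq]
    exact B.isEquivariantAt_triangle _ _ _ _ _
  tri_delta l := by
    simp [triangle, A.bdry_delta, H.s_one, H.μ_eq, f.delta_comm]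

namespace SimplicialHomotopy

lemma exists_edge_eq {f f' : A ⟶ B} (S : SimplicialHomotopy f f') (g : A.G) :
    ∃ x, S.edge g = B.k (f.φ g) * B.j x := by
  have h1 := B.edge_eq (S.edge g)
  have h2 := S.c₀_edge g
  rw [h1, map_mul, c₀_j, c₀_k, one_mul] at h2
  refine ⟨(f.φ g)⁻¹ • (S.edge g).left, ?_⟩
  rw [k_mul_j, smul_inv_smul, ← h2]
  exact h1

/-- A homotopy is determined by its simplices. -/
lemma exists_homotopy {f f' : A ⟶ B} (S : SimplicialHomotopy f f') :
    Nonempty (Homotopy f f') := by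
  choose s hs using S.exists_edge_eq
  have ht : ∀ a, ∃ t, S.tri a = B.triangle (f.ψ a) (s (A.bdry a)) t := fun a =>
    eq_triangle (S.d₀_tri a) (by rw [S.d₂_tri, hs, f.bdry_comm])
  choose t ht using ht
  have s_mul : ∀ g h : A.G, s (g * h) = ((f.φ h)⁻¹ • s g) * s h := fun g h => by
    have h' : ∀ g, B.j (s g) = (B.k (f.φ g))⁻¹ * S.edge g := fun g => by
      rw [hs, inv_mul_cancel_left]
    apply B.j_injective
    simp only [map_mul, map_inv, j_smul, h']
    group
  have ψ_eq : ∀ a : A.E, f'.ψ a = f.ψ a * s (A.bdry a) * B.delta (t a) := fun a => by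
    apply B.j_injective
    rw [← S.d₁_tri, ht]
    simp [triangle]
  have φ_eq : ∀ g : A.G, f'.φ g = f.φ g * B.bdry (s g) := fun g => by
    apply B.k_injective
    rw [← S.c₁_edge, hs]
    simp
  refine ⟨⟨⟨s, t, s_mul, fun a b => ?_, fun g a => ?_⟩, fun l => ?_, ψ_eq, φ_eq⟩⟩
  · have h := map_mul S.tri a b
    rw [ht, ht a, ht b, triangle_mul, map_mul, map_mul, s_mul, ← f.bdry_comm] at h
    rw [map_inv, ← f.bdry_comm]
    exact triangle_injective h
  -- For given edge, triangle and d₁-faces the relation determines the new triangle; comparing with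
  -- `isEquivariantAt_triangle` identifies its interior.
  · have h := S.equivariant g a
    have h' := B.isEquivariantAt_triangle (f.φ g) (s g) (f.ψ a) (s (A.bdry a)) (t a)
    rw [ht, ht, hs, s_smul_of_edge f hs, f.map_smul_E, f'.map_smul_E, ψ_eq, φ_eq] at h
    unfold TruncatedSimplicialGroup.IsEquivariantAt at h h'
    exact triangle_injective (mul_right_cancel (h.trans h'.symm))
  · have h := S.tri_delta l
    have s_one : s 1 = 1 := by simpa using s_mul 1 1
    rw [ht, A.bdry_delta, s_one, triangle, map_one, mul_one, ← f.delta_comm, mul_assoc,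
      mul_right_inj, ← map_inv, ← map_mul] at h
    change f'.μ l = f.μ l * t (A.delta l)
    rw [B.z_injective h, mul_inv_cancel_left]

/-- Homotopies with the same source compose to a homotopy between their targets, provided that
the `1`-simplices assigned to the base can be completed to `2`-simplices. -/
def fill {f₀ f₁ f₂ : A ⟶ B} (S : SimplicialHomotopy f₀ f₁) (S' : SimplicialHomotopy f₀ f₂)
    (σ : A.G →* B.Triangles) (h₀ : ∀ g, B.d₀ (σ g) = S.edge g)
    (h₁ : ∀ g, B.d₁ (σ g) = S'.edge g) : SimplicialHomotopy f₁ f₂ := by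
  have horn : ∀ a, B.nerve.IsHorn (S.tri a) (S'.tri a) (σ (A.bdry a)) := fun a =>
    ⟨(S.d₀_tri a).trans (S'.d₀_tri a).symm, (S.d₂_tri a).trans (h₀ _).symm,
      (S'.d₂_tri a).trans (h₁ _).symm⟩
  exact
  { edge := B.d₂.comp σ
    tri := MonoidHom.mk' (fun a => B.nerve.fill (S.tri a) (S'.tri a) (σ (A.bdry a)))
      fun a b => by
        rw [← TruncatedSimplicialGroup.fill_mul (horn a) (horn b), map_mul, map_mul, map_mul,
          map_mul]
    c₀_edge := fun g => (B.nerve.c₀_d₂ (σ g)).trans <| by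
      change B.c₁ (B.d₀ (σ g)) = _
      rw [h₀, S.c₁_edge]
    c₁_edge := fun g => (B.nerve.c₁_d₂ (σ g)).trans <| by
      change B.c₁ (B.d₁ (σ g)) = _
      rw [h₁, S'.c₁_edge]
    d₀_tri := fun a => (horn a).d₀_fill.trans (S.d₁_tri a)
    d₁_tri := fun a => (horn a).d₁_fill.trans (S'.d₁_tri a)
    d₂_tri := fun a => (horn a).d₂_fill
    equivariant := fun g a => by
      have e0 : B.nerve.c₁ (B.nerve.d₀ (σ g)) = B.k (f₁.φ g) :=
        (congrArg B.c₁ (h₀ g)).trans (S.c₁_edge g)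
      have e1 : B.nerve.c₁ (B.nerve.d₁ (σ g)) = B.k (f₂.φ g) :=
        (congrArg B.c₁ (h₁ g)).trans (S'.c₁_edge g)
      have e2 : B.nerve.c₁ (B.nerve.d₂ (σ g)) = B.k (f₂.φ g) := (B.nerve.c₁_d₂ _).trans e1
      have H := TruncatedSimplicialGroup.fill_isEquivariantAt (A' := S.tri (g • a))
        (C' := S'.tri (g • a)) (ν := σ g) (horn a)
        (S'.d₁_tri a) (S.d₁_tri a) (B.c₀_j _) (B.c₀_j _)
        (by
          change B.c₀ (B.d₀ (σ g)) = B.c₀ (B.d₁ (σ g))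
          rw [h₀, h₁, S.c₀_edge, S'.c₀_edge])
        (by
          rw [e0, ← j_smul, ← f₁.map_smul_E]
          change B.nerve.IsEquivariantAt (B.d₀ (σ g)) _ _ _ _
          rw [h₀]
          exact S.equivariant g a)
        (by
          rw [e1, ← j_smul, ← f₂.map_smul_E]
          change B.nerve.IsEquivariantAt (B.d₁ (σ g)) _ _ _ _
          rw [h₁]
          exact S'.equivariant g a)
      rw [e2, ← j_smul, ← f₂.map_smul_E, ← map_mul, ← map_inv, ← map_mul, ← A.bdry_smul] at H
      exact H
    tri_delta := fun l => by
      have d₂S : B.nerve.d₂ (S.tri (A.delta l)) = 1 := by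
        refine (S.d₂_tri _).trans ?_
        rw [A.bdry_delta, map_one]
      have d₁S : B.nerve.d₁ (S.tri (A.delta l)) = B.j (B.delta (f₁.μ l)) := by
        refine (S.d₁_tri _).trans ?_
        rw [f₁.delta_comm]
      change B.nerve.fill _ _ (σ _) = _
      rw [A.bdry_delta, map_one, TruncatedSimplicialGroup.fill, d₂S, d₁S, S.tri_delta,
        S'.tri_delta]
      change _ * B.s₀ _ = _
      -- The quotient of the two `z` terms lies in ker d₀ ∩ ker d₂, and q(δl) z(l)⁻¹ lies in ker d₁.
      have e1 : Commute (B.z (f₂.μ l) * (B.z (f₁.μ l))⁻¹)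
          (B.q (B.delta (f₀.μ l)) * (B.z (f₀.μ l))⁻¹)⁻¹ := by
        apply B.nerve.comm₀₂
        · change B.d₀ _ = 1
          simp
        · change B.d₂ _ = 1
          simp
        · change B.d₁ _ = 1
          simp
      have e2 : Commute (B.z (f₂.μ l) * (B.z (f₁.μ l))⁻¹)
          (B.q (B.delta (f₁.μ l)) * (B.z (f₁.μ l))⁻¹) := by
        apply B.nerve.comm₀₂
        · change B.d₀ _ = 1
          simp
        · change B.d₂ _ = 1
          simp
        · change B.d₁ _ = 1
          simp
      simp only [map_one, inv_one, mul_one, s₀_j]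
      have e1' := e1.eq
      have e2' := e2.eq
      generalize B.q (B.delta (f₀.μ l)) * (B.z (f₀.μ l))⁻¹ = ζ at *
      calc _ = ζ * ((B.z (f₂.μ l) * (B.z (f₁.μ l))⁻¹) * ζ⁻¹) * B.q (B.delta (f₁.μ l)) := by group
        _ = (B.z (f₂.μ l) * (B.z (f₁.μ l))⁻¹) * (B.q (B.delta (f₁.μ l)) * (B.z (f₁.μ l))⁻¹) *
              B.z (f₁.μ l) := by rw [e1']; group
        _ = _ := by rw [e2']; group }

end SimplicialHomotopy

end Homotopies

end TwoCrossedModule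

/-! ### Composition of homotopies with strict maps, and functoriality of Q¹. -/

namespace TwoCrossedModule

variable {A B C : TwoCrossedModule.{u}}

lemma comp_φ_apply (f : A ⟶ B) (g : B ⟶ C) (x : A.G) : (f ≫ g).φ x = g.φ (f.φ x) := rfl
lemma comp_ψ_apply (f : A ⟶ B) (g : B ⟶ C) (x : A.E) : (f ≫ g).ψ x = g.ψ (f.ψ x) := rfl
lemma comp_μ_apply (f : A ⟶ B) (g : B ⟶ C) (x : A.L) : (f ≫ g).μ x = g.μ (f.μ x) := rfl

lemma Hom.map_sec (f : A ⟶ B) (e : A.E) (l : A.L) : f.μ (A.sec e l) = B.sec (f.ψ e) (f.μ l) := by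
  rw [sec_def, sec_def, map_mul, f.map_lift, map_inv, ← f.delta_comm]

/-- The constant homotopy. -/
def Homotopy.refl (f : A ⟶ B) : Homotopy f f where
  s _ := 1
  t _ := 1
  s_mul := by simp
  t_mul a b := by
    simp [lift_one_right, lift_one_left, sec_def]
  t_smul g a := by
    simp [lift_one_left, lift_one_right, sec_one]
  μ_eq := by simp
  ψ_eq := by simp
  φ_eq := by simp

/-- Postcomposition of a homotopy with a strict map. -/
def Homotopy.postcomp {f f' : A ⟶ B} (H : Homotopy f f') (g : B ⟶ C) :
    Homotopy (f ≫ g) (f' ≫ g) where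
  s x := g.ψ (H.s x)
  t a := g.μ (H.t a)
  s_mul x y := by
    rw [H.s_mul, map_mul, g.map_smul_E, map_inv, comp_φ_apply]
  t_mul a b := by
    rw [H.t_mul]
    simp only [map_mul, map_inv, g.map_sec, g.map_lift, g.map_smul_E, comp_φ_apply, comp_ψ_apply]
  t_smul x a := by
    rw [H.t_smul]
    simp only [map_mul, map_inv, g.map_sec, g.map_lift, g.map_smul_L, comp_φ_apply, comp_ψ_apply,
      g.bdry_comm]
  μ_eq l := by rw [comp_μ_apply, H.μ_eq, map_mul, comp_μ_apply]
  ψ_eq a := by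
    rw [comp_ψ_apply, H.ψ_eq, map_mul, map_mul, comp_ψ_apply, g.delta_comm]
  φ_eq x := by rw [comp_φ_apply, H.φ_eq, map_mul, comp_φ_apply, g.bdry_comm]

/-- Precomposition of a homotopy with a strict map. -/
def Homotopy.precomp {f f' : B ⟶ C} (H : Homotopy f f') (g : A ⟶ B) :
    Homotopy (g ≫ f) (g ≫ f') where
  s x := H.s (g.φ x)
  t a := H.t (g.ψ a)
  s_mul x y := by
    rw [map_mul, H.s_mul, comp_φ_apply]
  t_mul a b := by
    rw [map_mul, H.t_mul]
    simp only [g.bdry_comm, comp_φ_apply, comp_ψ_apply, map_inv]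
  t_smul x a := by
    rw [g.map_smul_E, H.t_smul]
    simp only [g.bdry_comm, comp_φ_apply, comp_ψ_apply]
  μ_eq l := by rw [comp_μ_apply, H.μ_eq, g.delta_comm, comp_μ_apply]
  ψ_eq a := by rw [comp_ψ_apply, H.ψ_eq, g.bdry_comm, comp_ψ_apply]
  φ_eq x := by rw [comp_φ_apply, H.φ_eq, comp_φ_apply]

lemma freeProj_map (f : A ⟶ B) (v : FreeGroup A.G) :
    B.freeProj (FreeGroup.map f.φ v) = f.φ (A.freeProj v) := by
  suffices h : B.freeProj.comp (FreeGroup.map f.φ) = f.φ.comp A.freeProj from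
    DFunLike.congr_fun h v
  ext x
  simp [freeProj]

lemma map_conj {G K : Type*} [Group G] [Group K] (f : G →* K) (x y : G) :
    f (x * y * x⁻¹) = f x * f y * (f x)⁻¹ := by
  rw [map_mul, map_mul, map_inv]

/-- The functoriality of the partial resolution. -/
def Q1map (f : A ⟶ B) : A.Q1 ⟶ B.Q1 where
  μ := f.μ
  ψ := ((f.ψ.prodMap (FreeGroup.map f.φ)).comp A.pullbackE.subtype).codRestrict B.pullbackE
    fun x => by
      have hx : A.bdry x.1.1 = A.freeProj x.1.2 := x.2
      change B.bdry (f.ψ x.1.1) = B.freeProj (FreeGroup.map f.φ x.1.2)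
      rw [f.bdry_comm, hx, freeProj_map]
  φ := FreeGroup.map f.φ
  delta_comm l := by
    apply Subtype.ext
    apply Prod.ext
    · exact f.delta_comm l
    · exact (map_one (FreeGroup.map f.φ)).symm
  bdry_comm _ := rfl
  map_lift x y := f.map_lift x.1.1 y.1.1
  map_smul_L v l :=
    (f.map_smul_L (A.freeProj v) l).trans (congrArg (· • f.μ l) (freeProj_map f v).symm)
  map_smul_E v x := by
    apply Subtype.ext
    apply Prod.ext
    · exact (f.map_smul_E (A.freeProj v) x.1.1).trans
        (congrArg (· • f.ψ x.1.1) (freeProj_map f v).symm)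
    · exact map_conj (FreeGroup.map f.φ) v x.1.2

/-- Naturality of `proj` is what allows a lax homotopy to be precomposed with a strict map. -/
lemma Q1map_proj (f : A ⟶ B) : Q1map f ≫ B.proj = A.proj ≫ f := by
  apply Hom.ext
  · rfl
  · rfl
  · ext v
    exact freeProj_map f _

/-- Homotopies with the same source, defined on a partial resolution, yield a homotopy between
their targets. -/
lemma Homotopy.nonempty_of_common_source {f₀ f₁ f₂ : A.Q1 ⟶ B} (H : Homotopy f₀ f₁)
    (H' : Homotopy f₀ f₂) : Nonempty (Homotopy f₁ f₂) := by
  let S := H.toSimplicial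
  let S' := H'.toSimplicial
  let x : A.G → A.Q1.G := FreeGroup.of
  -- This is the only use of freeness. On a generator with edges x and y, s₀(x) s₁(x⁻¹y) fills the
  -- horn: its faces d₀ and d₁ are x and y because c₀(x) = c₀(y), the source map being common.
  let σ : A.Q1.G →* B.Triangles := FreeGroup.lift fun g =>
    B.s₀ (S.edge (x g)) * B.s₁ ((S.edge (x g))⁻¹ * S'.edge (x g))
  have hσ : ∀ g, σ (x g) = B.s₀ (S.edge (x g)) * B.s₁ ((S.edge (x g))⁻¹ * S'.edge (x g)) :=
    fun g => FreeGroup.lift_apply_of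
  have h₀ : B.d₀.comp σ = S.edge := by
    refine FreeGroup.ext_hom _ _ fun g => ?_
    change B.d₀ (σ (x g)) = S.edge (x g)
    rw [hσ, map_mul]
    refine (congrArg₂ _ (B.nerve.d₀_s₀ _) (B.nerve.d₀_s₁ _)).trans ?_
    change S.edge (x g) * B.c₀ _ = _
    rw [map_mul, map_inv, S.c₀_edge, S'.c₀_edge, inv_mul_cancel, mul_one]
  have h₁ : B.d₁.comp σ = S'.edge := by
    refine FreeGroup.ext_hom _ _ fun g => ?_
    change B.d₁ (σ (x g)) = S'.edge (x g)
    rw [hσ, map_mul]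
    refine (congrArg₂ _ (B.nerve.d₁_s₀ _) (B.nerve.d₁_s₁ _)).trans ?_
    rw [mul_inv_cancel_left]
  exact (S.fill S' σ (DFunLike.congr_fun h₀) (DFunLike.congr_fun h₁)).exists_homotopy

/-! ### The congruence and its quotient category. -/

/-- The relation of lax homotopy. -/
def laxHomotopic : HomRel TwoCrossedModule.{u} := fun _ _ f f' => Nonempty (LaxHomotopy f f')

instance : Congruence laxHomotopic.{u} where
  equivalence := by
    intro A B
    have hr : ∀ f : A ⟶ B, laxHomotopic f f := fun f => ⟨Homotopy.refl _⟩
    -- Together with reflexivity this gives symmetry (take f₂ = f₀) and then transitivity (reverse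
    -- the first homotopy).
    have he : ∀ {f₀ f₁ f₂ : A ⟶ B}, laxHomotopic f₀ f₁ → laxHomotopic f₀ f₂ →
        laxHomotopic f₁ f₂ := fun ⟨H⟩ ⟨H'⟩ => Homotopy.nonempty_of_common_source H H'
    exact ⟨hr, fun h => he h (hr _), fun h h' => he (he h (hr _)) h'⟩
  comp_left f _ _ h := by
    obtain ⟨H⟩ := h
    refine ⟨?_⟩
    unfold LaxHomotopy
    rw [← Category.assoc, ← Category.assoc, ← Q1map_proj, Category.assoc, Category.assoc]
    exact H.precomp (Q1map f)
  comp_right g h := by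
    obtain ⟨H⟩ := h
    refine ⟨?_⟩
    unfold LaxHomotopy
    rw [← Category.assoc, ← Category.assoc]
    exact H.postcomp g

/-- Since lax homotopy is a congruence, equality in the quotient is lax homotopy itself, without
passing to a generated relation. As the quotient functor is full, an inverse in the quotient lifts
to a strict map. -/
lemma laxHomotopyEquivalences_eq :
    laxHomotopyEquivalences.{u} =
      (MorphismProperty.isomorphisms _).inverseImage (Quotient.functor laxHomotopic.{u}) := by
  ext A B f
  simp only [MorphismProperty.inverseImage_iff, MorphismProperty.isomorphisms.iff]
  constructor
  · rintro ⟨g, h, h'⟩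
    refine ⟨(Quotient.functor _).map g, ?_, ?_⟩
    · rw [← Functor.map_comp, ← CategoryTheory.Functor.map_id]
      exact ((Quotient.functor_map_eq_iff _ _ _).2 h).symm
    · rw [← Functor.map_comp, ← CategoryTheory.Functor.map_id]
      exact ((Quotient.functor_map_eq_iff _ _ _).2 h').symm
  · rintro ⟨g', h, h'⟩
    obtain ⟨g, rfl⟩ := (Quotient.functor laxHomotopic.{u}).map_surjective g'
    rw [← Functor.map_comp, ← CategoryTheory.Functor.map_id] at h h'
    exact ⟨g, (Quotient.functor_map_eq_iff laxHomotopic _ _).1 h.symm,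
      (Quotient.functor_map_eq_iff laxHomotopic _ _).1 h'.symm⟩

end TwoCrossedModule

theorem mainTheorem11 :
    (TwoCrossedModule.laxHomotopyEquivalences.{u}).IsStableUnderComposition ∧
    (TwoCrossedModule.laxHomotopyEquivalences.{u}).HasTwoOutOfThreeProperty ∧
    (TwoCrossedModule.laxHomotopyEquivalences.{u}).IsStableUnderRetracts := by
  rw [TwoCrossedModule.laxHomotopyEquivalences_eq]
  exact ⟨inferInstance, inferInstance, inferInstance⟩
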